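/- Let $\mathfrak H$ be a complex Hilbert space (for instance $L^2(\mathbb R^d)$). Let $\mathfrak H_a^n=\bigwedge^n\mathfrak H$ be the Hilbert space antisymmetric tensor product, with $\langle f_1\wedge\dots\wedge f_n,g_1\wedge\dots\wedge g_n\rangle=\det(\langle f_i,g_j\rangle)$, let $\mathcal F=\bigoplus_{n\ge0}\mathfrak H_a^n$ be the fermionic Fock space and $\mathcal F^{\le N}=\bigoplus_{n=0}^N\mathfrak H_a^n$. Let $a^\dagger(f)\psi=f\wedge\psi$ and $a(f)=a^\dagger(f)^*$. A state on a Hilbert space is a non-negative self-adjoint trace-class operator of trace one; states on $\mathfrak H^n_a$ or $\mathcal F^{\le N}$ are extended by zero to $\mathcal F$. The density matrices $[\Gamma]^{(p,q)}:\mathfrak H_a^q\to\mathfrak H_a^p$ of a state $\Gamma$ on some $\mathcal F^{\le M}$ are defined by $$\langle g_1\wedge\dots\wedge g_p,[\Gamma]^{(p,q)}f_1\wedge\dots\wedge f_q\rangle=\operatorname{tr}\big(\Gamma\,a^\dagger(f_1)\cdots a^\dagger(f_q)a(g_p)\cdots a(g_1)\big).$$ For a bounded operator $B$ on $\mathfrak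 H$ with $0\le BB^*\le1$, the $B$-localization of a state $\Gamma$ on $\mathcal F^{\le N}$ is the state $\Gamma_B$ on $\mathcal F^{\le N}$ such that $[\Gamma_B]^{(p,q)}=B^{\otimes p}[\Gamma]^{(p,q)}(B^*)^{\otimes q}$ for all $p,q$. The rank of $\Gamma$ is the smallest rank of an orthogonal projection $P$ of $\mathfrak H$ with $\Gamma_P=\Gamma$ ($\infty$ if there is no such $P$ of finite rank). States $\Gamma_n$ on $\mathcal F^{\le N}$ converge geometrically to a state $\Gamma$ on $\mathcal F^{\le N}$ if $[\Gamma_n]^{(p,q)}\to[\Gamma]^{(p,q)}$ weakly for all $p,q$. Let $N,r\ge0$ be integers. (1) Let $G$ be a state on $\mathfrak H_a^N$ of rank $\le r$, let $\Gamma=0\oplus\dots\oplus0\oplus G$, and let $B$ be a bounded operator on $\mathfrak H$ with $0\le BB^*\le1$. Then the $B$-localization $\Gamma_B$ exists, is unique, and is block diagonal, $\Gamma_B=G^B_{00}\oplus\dots\oplus G^B_{NN}$. For every $0\le k\le N$ there are finitely many states $S^k_j$ on $\mathfrak H_a^k$ and numbers $\alpha^k_j\ge0$ with $$G^B_{kk}=\sum_j\alpha^k_jS^k_j,\qquad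 \sum_j\alpha_j^k=\operatorname{tr}G_{kk}^B,\qquad \operatorname{rank}(S^k_j)\le r-N+k .$$ (2) Let $G^n$ be states on $\mathfrak H_a^N$ of rank $\le r$ such that $\Gamma_n=0\oplus\dots\oplus0\oplus G^n$ converges geometrically to a state $\Gamma$ on $\mathcal F^{\le N}$. Then $\Gamma=G_{00}\oplus\dots\oplus G_{NN}$ is block diagonal, and for every $0\le k\le N$ there are finitely many states $S^k_j$ on $\mathfrak H_a^k$ and numbers $\alpha^k_j\ge0$ with $$G_{kk}=\sum_j\alpha^k_jS^k_j,\qquad \sum_j\alpha_j^k=\operatorname{tr}G_{kk},\qquad \operatorname{rank}(S^k_j)\le r-N+k .$$ -/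

import Mathlib

open scoped InnerProductSpace ComplexConjugate
open Filter Topology

namespace Fermi

universe u

section Form

variable {H : Type u} [NormedAddCommGroup H] [InnerProductSpace ℂ H]

/-- The contraction `f ⌟ ·` on the exterior algebra, the antiderivation with `f ⌟ g = ⟪f, g⟫`. -/
noncomputable def contract (f : H) : ExteriorAlgebra ℂ H →ₗ[ℂ] ExteriorAlgebra ℂ H :=
  CliffordAlgebra.contractLeft (innerₛₗ ℂ f)

theorem contract_ι_mul (f g : H) (x : ExteriorAlgebra ℂ H) :
    contract f (ExteriorAlgebra.ι ℂ g * x) =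
      ⟪f, g⟫_ℂ • x - ExteriorAlgebra.ι ℂ g * contract f x :=
  CliffordAlgebra.contractLeft_ι_mul _ _ _

theorem contract_algebraMap (f : H) (c : ℂ) :
    contract f (algebraMap ℂ (ExteriorAlgebra ℂ H) c) = 0 :=
  CliffordAlgebra.contractLeft_algebraMap _ _ _

theorem contract_contract (f : H) (x : ExteriorAlgebra ℂ H) : contract f (contract f x) = 0 :=
  CliffordAlgebra.contractLeft_contractLeft _ _

theorem contract_add (f g : H) (x : ExteriorAlgebra ℂ H) :
    contract (f + g) x = contract f x + contract g x := by
  simp [contract]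

theorem contract_smul (c : ℂ) (f : H) (x : ExteriorAlgebra ℂ H) :
    contract (c • f) x = conj c • contract f x := by
  simp [contract]

/-- The operator `φ ↦ φ ∘ (g ⌟ ·)` on antilinear functionals; it is linear in `g`. -/
noncomputable def pullContract :
    H →ₗ[ℂ] (ExteriorAlgebra ℂ H →ₛₗ[starRingEnd ℂ] ℂ) →ₗ[ℂ]
      (ExteriorAlgebra ℂ H →ₛₗ[starRingEnd ℂ] ℂ) :=
  LinearMap.mk₂ ℂ (fun g φ => φ.comp (contract g))
    (fun g g' φ => by ext x; simp [contract_add])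
    (fun c g φ => by ext x; simp [contract_smul])
    (fun g φ φ' => by ext x; simp)
    (fun c g φ => by ext x; simp)

/-- The antilinear functional `x ↦ conj (x₀)`, with `x₀` the component of degree `0` of `x`. -/
noncomputable def vacuumFunctional : ExteriorAlgebra ℂ H →ₛₗ[starRingEnd ℂ] ℂ where
  toFun x := conj (ExteriorAlgebra.algebraMapInv x)
  map_add' x y := by simp
  map_smul' c x := by simp

/-- The Fock inner product on the exterior algebra, antilinear in the first argument: the one for
which `1` is a unit vector orthogonal to all products and multiplication by `g` on the left is
adjoint to the contraction with `g`. -/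
noncomputable def fockForm (x y : ExteriorAlgebra ℂ H) : ℂ :=
  CliffordAlgebra.foldr (0 : QuadraticForm ℂ H) pullContract
    (fun g φ => by ext x; simp [pullContract, contract_contract]) vacuumFunctional y x

theorem fockForm_add_left (x x' y : ExteriorAlgebra ℂ H) :
    fockForm (x + x') y = fockForm x y + fockForm x' y := by simp [fockForm]

theorem fockForm_smul_left (c : ℂ) (x y : ExteriorAlgebra ℂ H) :
    fockForm (c • x) y = conj c * fockForm x y := by simp [fockForm]

theorem fockForm_add_right (x y y' : ExteriorAlgebra ℂ H) :
    fockForm x (y + y') = fockForm x y + fockForm x y' := by simp [fockForm]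

theorem fockForm_smul_right (c : ℂ) (x y : ExteriorAlgebra ℂ H) :
    fockForm x (c • y) = c * fockForm x y := by simp [fockForm]

theorem fockForm_algebraMap (x : ExteriorAlgebra ℂ H) (c : ℂ) :
    fockForm x (algebraMap ℂ _ c) = c * conj (ExteriorAlgebra.algebraMapInv x) := by
  simp [fockForm, CliffordAlgebra.foldr_algebraMap, vacuumFunctional]

theorem fockForm_ι_mul_right (g : H) (x y : ExteriorAlgebra ℂ H) :
    fockForm x (ExteriorAlgebra.ι ℂ g * y) = fockForm (contract g x) y := by
  simp [fockForm, CliffordAlgebra.foldr_mul, CliffordAlgebra.foldr_ι, pullContract]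

theorem fockForm_sub_left (x x' y : ExteriorAlgebra ℂ H) :
    fockForm (x - x') y = fockForm x y - fockForm x' y := by simp [fockForm]

theorem fockForm_sub_right (x y y' : ExteriorAlgebra ℂ H) :
    fockForm x (y - y') = fockForm x y - fockForm x y' := by simp [fockForm]

theorem fockForm_ι_mul_left (g : H) (x y : ExteriorAlgebra ℂ H) :
    fockForm (ExteriorAlgebra.ι ℂ g * x) y = fockForm x (contract g y) := by
  induction y using CliffordAlgebra.left_induction generalizing x with
  | algebraMap c =>
    rw [contract_algebraMap, fockForm_algebraMap]
    simp [fockForm, ExteriorAlgebra.algebraMapInv]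
  | add y y' hy hy' => simp only [fockForm_add_right, map_add, hy, hy']
  | ι_mul y h hy =>
    have e1 := fockForm_ι_mul_right h (ExteriorAlgebra.ι ℂ g * x) y
    have e2 := fockForm_ι_mul_right h x (contract g y)
    have e3 := contract_ι_mul g h y
    rw [ExteriorAlgebra.ι] at e1 e2 e3
    rw [e1, e3, fockForm_sub_right, e2, contract_ι_mul, fockForm_sub_left, hy, fockForm_smul_left,
      fockForm_smul_right, inner_conj_symm]

theorem fockForm_symm (x y : ExteriorAlgebra ℂ H) : conj (fockForm y x) = fockForm x y := by
  induction y using CliffordAlgebra.left_induction generalizing x with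
  | algebraMap c =>
    rw [fockForm_algebraMap]
    induction x using CliffordAlgebra.left_induction with
    | algebraMap d =>
      rw [fockForm_algebraMap]
      simp [mul_comm, ExteriorAlgebra.algebraMapInv]
    | add x x' hx hx' => simp only [fockForm_add_right, map_add, hx, hx', mul_add]
    | ι_mul x h hx =>
      have e1 := fockForm_ι_mul_right h (algebraMap ℂ _ c) x
      rw [ExteriorAlgebra.ι] at e1
      rw [e1, contract_algebraMap]
      simp [fockForm, ExteriorAlgebra.algebraMapInv]
  | add y y' hy hy' => simp only [fockForm_add_right, fockForm_add_left, map_add, hy, hy']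
  | ι_mul y h hy =>
    have e1 := fockForm_ι_mul_right h x y
    have e2 := fockForm_ι_mul_left h y x
    rw [ExteriorAlgebra.ι] at e1 e2
    rw [e1, e2, hy]

/-- The subalgebra generated by the vectors of `s`. -/
noncomputable abbrev genBy (s : Set H) : Subalgebra ℂ (ExteriorAlgebra ℂ H) :=
  Algebra.adjoin ℂ (ExteriorAlgebra.ι ℂ '' s)

theorem genBy_induction {s : Set H} {p : ExteriorAlgebra ℂ H → Prop}
    (h0 : ∀ c, p (algebraMap ℂ _ c)) (hadd : ∀ x y, p x → p y → p (x + y))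
    (hsmul : ∀ (c : ℂ) x, p x → p (c • x))
    (hmul : ∀ g ∈ s, ∀ x ∈ genBy s, p x → p (ExteriorAlgebra.ι ℂ g * x))
    {x : ExteriorAlgebra ℂ H} (hx : x ∈ genBy s) : p x := by
  have key : ∀ z ∈ genBy s, ∀ w ∈ genBy s, p w → (z * w ∈ genBy s ∧ p (z * w)) := by
    intro z hz
    induction hz using Algebra.adjoin_induction with
    | mem z hz =>
      obtain ⟨g, hg, rfl⟩ := hz
      exact fun w hw pw => ⟨mul_mem (Algebra.subset_adjoin ⟨g, hg, rfl⟩) hw, hmul g hg w hw pw⟩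
    | algebraMap c =>
      intro w hw pw
      rw [← Algebra.smul_def]
      exact ⟨Subalgebra.smul_mem _ hw c, hsmul c w pw⟩
    | add z z' hz hz' ih ih' =>
      intro w hw pw
      rw [add_mul]
      exact ⟨add_mem (ih w hw pw).1 (ih' w hw pw).1, hadd _ _ (ih w hw pw).2 (ih' w hw pw).2⟩
    | mul z z' hz hz' ih ih' =>
      intro w hw pw
      rw [mul_assoc]
      exact ih _ (ih' w hw pw).1 (ih' w hw pw).2
  have := (key x hx 1 (one_mem _) (by simpa using h0 1)).2
  simpa using this

theorem contract_eq_zero {s : Set H} {e : H} (he : ∀ g ∈ s, ⟪e, g⟫_ℂ = 0)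
    {x : ExteriorAlgebra ℂ H} (hx : x ∈ genBy s) : contract e x = 0 := by
  refine genBy_induction (p := fun x => contract e x = 0) (fun c => contract_algebraMap e c)
    (fun x y hx hy => ?_) (fun c x hx => ?_) (fun g hg x _ hx => ?_) hx
  · rw [map_add, hx, hy, add_zero]
  · rw [map_smul, hx, smul_zero]
  · rw [contract_ι_mul, he g hg, hx, zero_smul, mul_zero, sub_zero]

theorem exists_decomp {s : Set H} {e : H} {x : ExteriorAlgebra ℂ H}
    (hx : x ∈ genBy (insert e s)) :
    ∃ u ∈ genBy s, ∃ v ∈ genBy s, x = u + ExteriorAlgebra.ι ℂ e * v := by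
  refine genBy_induction
    (p := fun x => ∃ u ∈ genBy s, ∃ v ∈ genBy s, x = u + ExteriorAlgebra.ι ℂ e * v)
    (fun c => ⟨_, Subalgebra.algebraMap_mem _ c, 0, zero_mem _, by simp⟩) ?_ ?_ ?_ hx
  · rintro _ _ ⟨u, hu, v, hv, rfl⟩ ⟨u', hu', v', hv', rfl⟩
    exact ⟨u + u', add_mem hu hu', v + v', add_mem hv hv', by rw [mul_add]; abel⟩
  · rintro c _ ⟨u, hu, v, hv, rfl⟩
    exact ⟨c • u, Subalgebra.smul_mem _ hu c, c • v, Subalgebra.smul_mem _ hv c,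
      by rw [smul_add, mul_smul_comm]⟩
  · rintro g hg _ - ⟨u, hu, v, hv, rfl⟩
    rcases hg with rfl | hg
    · exact ⟨0, zero_mem _, u, hu, by
        rw [mul_add, ← mul_assoc, ExteriorAlgebra.ι_sq_zero, zero_mul, add_zero, zero_add]⟩
    · have hg' := Algebra.subset_adjoin (R := ℂ) (Set.mem_image_of_mem (ExteriorAlgebra.ι ℂ) hg)
      refine ⟨_, mul_mem hg' hu, _, neg_mem (mul_mem hg' hv), ?_⟩
      rw [mul_add, ← mul_assoc, mul_neg, ← mul_assoc,
        eq_neg_of_add_eq_zero_left (ExteriorAlgebra.ι_add_mul_swap (R := ℂ) g e), neg_mul]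

theorem fockForm_self_nonneg_aux (s : Finset H) (hs : Orthonormal ℂ ((↑) : s → H))
    {x : ExteriorAlgebra ℂ H} (hx : x ∈ genBy (s : Set H)) : 0 ≤ (fockForm x x).re := by
  classical
  induction s using Finset.induction_on generalizing x with
  | empty =>
    rw [genBy, Finset.coe_empty, Set.image_empty, Algebra.adjoin_empty] at hx
    obtain ⟨c, rfl⟩ := Algebra.mem_bot.mp hx
    rw [fockForm_algebraMap, ExteriorAlgebra.algebraMap_leftInverse H c, Complex.mul_conj,
      Complex.ofReal_re]
    exact Complex.normSq_nonneg c
  | insert e s he ih =>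
    rw [Finset.coe_insert] at hx
    obtain ⟨u, hu, v, hv, rfl⟩ := exists_decomp hx
    have hs' : Orthonormal ℂ ((↑) : s → H) :=
      hs.comp (fun a : s => (⟨a, Finset.mem_insert_of_mem a.2⟩ : (insert e s : Finset H)))
        (fun a b h => Subtype.ext (Subtype.mk.inj h))
    have hes : ∀ g ∈ (s : Set H), ⟪e, g⟫_ℂ = 0 := fun g hg =>
      hs.2 (i := ⟨e, Finset.mem_insert_self _ _⟩) (j := ⟨g, Finset.mem_insert_of_mem hg⟩)
        (fun h => he (by rw [Subtype.mk.inj h]; exact hg))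
    have hee : ⟪e, e⟫_ℂ = 1 := by
      have := hs.1 ⟨e, Finset.mem_insert_self _ _⟩
      simp only at this
      rw [inner_self_eq_norm_sq_to_K, this]; norm_num
    have cu := contract_eq_zero hes hu
    have cv := contract_eq_zero hes hv
    have : fockForm (u + ExteriorAlgebra.ι ℂ e * v) (u + ExteriorAlgebra.ι ℂ e * v)
        = fockForm u u + fockForm v v := by
      rw [fockForm_add_left, fockForm_add_right, fockForm_add_right, fockForm_ι_mul_right,
        fockForm_ι_mul_left, fockForm_ι_mul_left, contract_ι_mul, cu, cv, hee]
      simp [fockForm]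
    rw [this, Complex.add_re]
    exact add_nonneg (ih hs' hu) (ih hs' hv)

theorem exists_finset (x : ExteriorAlgebra ℂ H) : ∃ t : Finset H, x ∈ genBy (t : Set H) := by
  classical
  have mono : ∀ {s t : Finset H}, s ⊆ t → genBy (s : Set H) ≤ genBy (t : Set H) := fun h =>
    Algebra.adjoin_mono (Set.image_mono (by exact_mod_cast h))
  induction x using ExteriorAlgebra.induction with
  | algebraMap c => exact ⟨∅, Subalgebra.algebraMap_mem _ c⟩
  | ι f => exact ⟨{f}, Algebra.subset_adjoin ⟨f, by simp, rfl⟩⟩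
  | mul x y hx hy =>
    obtain ⟨s, hs⟩ := hx
    obtain ⟨t, ht⟩ := hy
    exact ⟨s ∪ t, mul_mem (mono Finset.subset_union_left hs) (mono Finset.subset_union_right ht)⟩
  | add x y hx hy =>
    obtain ⟨s, hs⟩ := hx
    obtain ⟨t, ht⟩ := hy
    exact ⟨s ∪ t, add_mem (mono Finset.subset_union_left hs) (mono Finset.subset_union_right ht)⟩

theorem fockForm_self_nonneg (x : ExteriorAlgebra ℂ H) : 0 ≤ (fockForm x x).re := by
  classical
  obtain ⟨t, ht⟩ := exists_finset x
  obtain ⟨s, hs, hspan⟩ : ∃ s : Finset H, Orthonormal ℂ ((↑) : s → H) ∧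
      (t : Set H) ⊆ Submodule.span ℂ (s : Set H) := by
    obtain ⟨w, b, hb⟩ := exists_orthonormalBasis ℂ (Submodule.span ℂ (t : Set H))
    have ho : Orthonormal ℂ (fun i => (b i : H)) :=
      b.orthonormal.comp_linearIsometry (Submodule.span ℂ (t : Set H)).subtypeₗᵢ
    refine ⟨Finset.univ.image fun i => (b i : H), ?_, ?_⟩
    · have := ho.toSubtypeRange
      convert! this using 2 <;> simp
    · intro g hg
      have h1 : (⟨g, Submodule.subset_span hg⟩ : Submodule.span ℂ (t : Set H)) ∈
          Submodule.span ℂ (Set.range b) := by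
        rw [← b.coe_toBasis, b.toBasis.span_eq]; trivial
      have h2 := Submodule.mem_map_of_mem (f := (Submodule.span ℂ (t : Set H)).subtype) h1
      rw [Submodule.map_span, ← Set.range_comp] at h2
      rw [Finset.coe_image, Finset.coe_univ, Set.image_univ]
      exact h2
  refine fockForm_self_nonneg_aux s hs (Algebra.adjoin_le ?_ ht)
  rintro _ ⟨g, hg, rfl⟩
  have : ExteriorAlgebra.ι ℂ g ∈ (Submodule.span ℂ (s : Set H)).map (ExteriorAlgebra.ι ℂ) :=
    ⟨g, hspan hg, rfl⟩
  rw [Submodule.map_span] at this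
  exact Algebra.span_le_adjoin ℂ _ this


theorem fockForm_ι_mul_self_le (f : H) (x : ExteriorAlgebra ℂ H) :
    (fockForm (ExteriorAlgebra.ι ℂ f * x) (ExteriorAlgebra.ι ℂ f * x)).re ≤
      ‖f‖ ^ 2 * (fockForm x x).re := by
  have h : fockForm (ExteriorAlgebra.ι ℂ f * x) (ExteriorAlgebra.ι ℂ f * x) =
      (‖f‖ ^ 2 : ℝ) * fockForm x x - fockForm (contract f x) (contract f x) := by
    rw [fockForm_ι_mul_left, contract_ι_mul, fockForm_sub_right, fockForm_smul_right,
      fockForm_ι_mul_right, inner_self_eq_norm_sq_to_K]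
    norm_num
  rw [h, Complex.sub_re, Complex.re_ofReal_mul]
  linarith [fockForm_self_nonneg (contract f x)]

end Form

section Fock

variable (H : Type u) [NormedAddCommGroup H] [InnerProductSpace ℂ H]

/-- The exterior algebra, carrying the Fock (semi-)inner product. -/
def AlgFock : Type u := ExteriorAlgebra ℂ H

noncomputable instance : AddCommGroup (AlgFock H) :=
  inferInstanceAs (AddCommGroup (ExteriorAlgebra ℂ H))

noncomputable instance : Module ℂ (AlgFock H) := inferInstanceAs (Module ℂ (ExteriorAlgebra ℂ H))

noncomputable instance algFockCore : PreInnerProductSpace.Core ℂ (AlgFock H) where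
  inner x y := fockForm (H := H) x y
  conj_inner_symm x y := fockForm_symm (H := H) x y
  re_inner_nonneg x := fockForm_self_nonneg (H := H) x
  add_left x y z := fockForm_add_left (H := H) x y z
  smul_left x y c := fockForm_smul_left (H := H) c x y

noncomputable instance : SeminormedAddCommGroup (AlgFock H) :=
  InnerProductSpace.Core.toSeminormedAddCommGroup (𝕜 := ℂ)

noncomputable instance : InnerProductSpace ℂ (AlgFock H) := InnerProductSpace.ofCore _

variable {H} in
theorem algFock_norm_sq (x : AlgFock H) : ‖x‖ ^ 2 = (fockForm (H := H) x x).re :=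
  norm_sq_eq_re_inner (𝕜 := ℂ) x

/-- The fermionic Fock space over `H`. -/
abbrev Fock : Type u := UniformSpace.Completion (AlgFock H)

variable {H}

/-- An element of the exterior algebra as a vector of the Fock space. -/
noncomputable def toFock (x : ExteriorAlgebra ℂ H) : Fock H :=
  UniformSpace.Completion.coe' (α := AlgFock H) x

/-- `f₁ ∧ ⋯ ∧ fₙ` as a vector of the Fock space. -/
noncomputable def wedge {n : ℕ} (f : Fin n → H) : Fock H :=
  toFock (ExteriorAlgebra.ιMulti ℂ n f)

/-- `x ↦ f ∧ x` on the exterior algebra. -/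
noncomputable def algCreate (f : H) : AlgFock H →L[ℂ] AlgFock H :=
  LinearMap.mkContinuous
    (LinearMap.mulLeft ℂ (ExteriorAlgebra.ι ℂ f) : ExteriorAlgebra ℂ H →ₗ[ℂ] ExteriorAlgebra ℂ H)
    ‖f‖ (fun x => by
      refine le_of_sq_le_sq ?_ (by positivity)
      rw [mul_pow, algFock_norm_sq, algFock_norm_sq]
      exact fockForm_ι_mul_self_le f x)

/-- The creation operator `a†(f)`, the continuous extension of `ψ ↦ f ∧ ψ`. -/
noncomputable def create (f : H) : Fock H →L[ℂ] Fock H := (algCreate f).completion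

/-- The annihilation operator `a(f)`. -/
noncomputable def annihilate (f : H) : Fock H →L[ℂ] Fock H :=
  ContinuousLinearMap.adjoint (create f)

theorem inner_toFock (x y : ExteriorAlgebra ℂ H) : ⟪toFock x, toFock y⟫_ℂ = fockForm x y :=
  UniformSpace.Completion.inner_coe (𝕜 := ℂ) (E := AlgFock H) _ _

theorem create_toFock (f : H) (x : ExteriorAlgebra ℂ H) :
    create f (toFock x) = toFock (ExteriorAlgebra.ι ℂ f * x) :=
  ContinuousLinearMap.completion_apply_coe (algCreate f) (x : AlgFock H)

theorem contract_ιMulti (f : H) {n : ℕ} (g : Fin (n + 1) → H) :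
    contract f (ExteriorAlgebra.ιMulti ℂ (n + 1) g) =
      ∑ j : Fin (n + 1), ((-1) ^ (j : ℕ) * ⟪f, g j⟫_ℂ) •
        ExteriorAlgebra.ιMulti ℂ n (fun i => g (j.succAbove i)) := by
  induction n with
  | zero =>
    rw [ExteriorAlgebra.ιMulti_succ_apply, contract_ι_mul]
    have := contract_algebraMap f (1 : ℂ)
    rw [map_one] at this
    simp [this]
  | succ n ih =>
    rw [ExteriorAlgebra.ιMulti_succ_apply, contract_ι_mul, ih, Finset.mul_sum, Fin.sum_univ_succ (n := n + 1),
      sub_eq_add_neg, ← Finset.sum_neg_distrib]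
    congr 1
    · simp [Matrix.vecTail, Function.comp_def]
    · refine Finset.sum_congr rfl fun j _ => ?_
      rw [ExteriorAlgebra.ιMulti_succ_apply (fun i => g (j.succ.succAbove i)), mul_smul_comm,
        ← neg_smul]
      simp [Matrix.vecTail, Function.comp_def, pow_succ]

theorem fockForm_sum_right {κ : Type*} (s : Finset κ) (x : ExteriorAlgebra ℂ H)
    (y : κ → ExteriorAlgebra ℂ H) : fockForm x (∑ i ∈ s, y i) = ∑ i ∈ s, fockForm x (y i) := by
  simp [fockForm]

/-- The inner product of two `n`-fold wedge products is their Gram determinant, so that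
`f₁ ∧ ⋯ ∧ fₙ` has norm one when the `fᵢ` are orthonormal. -/
theorem inner_wedge_wedge {n : ℕ} (f g : Fin n → H) :
    ⟪wedge f, wedge g⟫_ℂ = Matrix.det (Matrix.of fun i j => ⟪f i, g j⟫_ℂ) := by
  rw [wedge, wedge, inner_toFock]
  induction n with
  | zero =>
    have := fockForm_algebraMap (1 : ExteriorAlgebra ℂ H) (1 : ℂ)
    rw [map_one, map_one] at this
    simpa using this
  | succ n ih =>
    rw [ExteriorAlgebra.ιMulti_succ_apply, fockForm_ι_mul_left, contract_ιMulti,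
      Matrix.det_succ_row_zero]
    rw [fockForm_sum_right]
    refine Finset.sum_congr rfl fun j _ => ?_
    rw [fockForm_smul_right, ih]
    rfl

/-- Wedge products with different numbers of factors are orthogonal. -/
theorem inner_wedge_of_ne {m n : ℕ} (h : m ≠ n) (f : Fin m → H) (g : Fin n → H) :
    ⟪wedge f, wedge g⟫_ℂ = 0 := by
  rw [wedge, wedge, inner_toFock]
  have h1 (f : H) : contract f 1 = 0 := by simpa using contract_algebraMap f (1 : ℂ)
  have h2 (x : ExteriorAlgebra ℂ H) : fockForm x 0 = 0 := by simp [fockForm]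
  have h3 (x : ExteriorAlgebra ℂ H) : fockForm 0 x = 0 := by simp [fockForm]
  induction m generalizing n with
  | zero =>
    obtain _ | n := n
    · exact absurd rfl h
    · rw [ExteriorAlgebra.ιMulti_succ_apply, fockForm_ι_mul_right]
      simp [h1, h3]
  | succ m ih =>
    obtain _ | n := n
    · rw [ExteriorAlgebra.ιMulti_succ_apply, fockForm_ι_mul_left]
      simp [h1, h2]
    · rw [ExteriorAlgebra.ιMulti_succ_apply, fockForm_ι_mul_left, contract_ιMulti, fockForm_sum_right]
      refine Finset.sum_eq_zero fun j _ => ?_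
      rw [fockForm_smul_right, ih (by omega), mul_zero]

end Fock

section States

/-- A (mixed) state on the Hilbert space `X`: a positive (in particular self-adjoint) operator
which is trace class with trace one. -/
def IsState {X : Type u} [NormedAddCommGroup X] [InnerProductSpace ℂ X] (T : X →L[ℂ] X) : Prop :=
  T.IsPositive ∧ ∀ (κ : Type u) (b : HilbertBasis κ ℂ X), HasSum (fun i => ⟪b i, T (b i)⟫_ℂ) 1

/-- The trace `∑ ⟪e, T e⟫` over an orthonormal basis. For trace class operators, the only ones
it is used for below, the sum converges and does not depend on the basis. -/
noncomputable def trace {X : Type u} [NormedAddCommGroup X] [InnerProductSpace ℂ X]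
    [CompleteSpace X] (T : X →L[ℂ] X) : ℂ :=
  ∑' e : (exists_hilbertBasis ℂ X).choose, ⟪(e : X), T e⟫_ℂ

variable (H : Type u) [NormedAddCommGroup H] [InnerProductSpace ℂ H]

/-- The `n`-body space `⋀ⁿ H` (Hilbert space antisymmetric tensor product), the closed subspace of
the Fock space generated by the `f₁ ∧ ⋯ ∧ fₙ`. -/
noncomputable def sector (n : ℕ) : Submodule ℂ (Fock H) :=
  (Submodule.span ℂ (Set.range fun f : Fin n → H => wedge f)).topologicalClosure

instance (n : ℕ) : CompleteSpace (sector H n) :=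
  (Submodule.isClosed_topologicalClosure _).completeSpace_coe

/-- The truncated Fock space `ℂ ⊕ H ⊕ ⋯ ⊕ ⋀ᴺ H`. -/
noncomputable def truncatedFock (N : ℕ) : Submodule ℂ (Fock H) :=
  ⨆ n : Fin (N + 1), sector H n

variable {H}

/-- States on the truncated Fock space, extended by zero to the whole Fock space. -/
def IsTruncatedState (N : ℕ) (Γ : Fock H →L[ℂ] Fock H) : Prop :=
  IsState Γ ∧ ∀ ψ, Γ ψ ∈ truncatedFock H N

/-- `0 ⊕ ⋯ ⊕ 0 ⊕ G ⊕ 0 ⊕ ⋯` for an operator `G` on the `n`-body space. -/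
noncomputable def extendByZero (n : ℕ) (G : sector H n →L[ℂ] sector H n) :
    Fock H →L[ℂ] Fock H :=
  (sector H n).subtypeL ∘L G ∘L (sector H n).orthogonalProjectionOnto

/-- The diagonal block `G_{kk}` of `Γ` on the `k`-body space. -/
noncomputable def block (k : ℕ) (Γ : Fock H →L[ℂ] Fock H) : sector H k →L[ℂ] sector H k :=
  (sector H k).orthogonalProjectionOnto ∘L Γ ∘L (sector H k).subtypeL

/-- The density matrix `[Γ]^(p,q)` of `Γ`, through its defining matrix elements
`⟪g₁ ∧ ⋯ ∧ g_p, [Γ]^(p,q) f₁ ∧ ⋯ ∧ f_q⟫ = tr (Γ a†(f₁) ⋯ a†(f_q) a(g_p) ⋯ a(g₁))`. -/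
noncomputable def densityMatrix (Γ : Fock H →L[ℂ] Fock H) {p q : ℕ}
    (g : Fin p → H) (f : Fin q → H) : ℂ :=
  trace (Γ * (List.ofFn fun i => create (f i)).prod *
    (List.ofFn fun i => annihilate (g i)).reverse.prod)

/-- Geometric convergence: the density matrices of all orders converge weakly. -/
def GeomTendsto (Γs : ℕ → Fock H →L[ℂ] Fock H) (Γ : Fock H →L[ℂ] Fock H) : Prop :=
  ∀ (p q : ℕ) (g : Fin p → H) (f : Fin q → H),
    Tendsto (fun n => densityMatrix (Γs n) g f) atTop (𝓝 (densityMatrix Γ g f))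

variable [CompleteSpace H]

/-- `Γ'` is the `B`-localization of `Γ`: `[Γ']^(p,q) = B^{⊗p} [Γ]^(p,q) (B*)^{⊗q}`. The matrix
element of the right side between `g₁ ∧ ⋯ ∧ g_p` and `f₁ ∧ ⋯ ∧ f_q` is the one of `[Γ]^(p,q)`
between `B*g₁ ∧ ⋯ ∧ B*g_p` and `B*f₁ ∧ ⋯ ∧ B*f_q`. -/
def IsLocalization (B : H →L[ℂ] H) (Γ Γ' : Fock H →L[ℂ] Fock H) : Prop :=
  ∀ (p q : ℕ) (g : Fin p → H) (f : Fin q → H),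
    densityMatrix Γ' g f =
      densityMatrix Γ (fun i => B.adjoint (g i)) (fun i => B.adjoint (f i))

/-- The rank of a state on the Fock space: the smallest rank of an orthogonal projection `P` of
the one-body space with `Γ_P = Γ`. This is not the rank of the operator `Γ`. -/
noncomputable def stateRank (Γ : Fock H →L[ℂ] Fock H) : ℕ∞ :=
  ⨅ (P : H →L[ℂ] H) (_ : IsStarProjection P ∧ IsLocalization P Γ Γ),
    Cardinal.toENat (LinearMap.rank (P : H →ₗ[ℂ] H))

/-- `T` is a finite combination `∑ αⱼ Sⱼ` of `k`-body states `Sⱼ` of rank at most `r - N + k`,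
with weights `αⱼ ≥ 0` of total mass `tr T`. -/
def IsRankCombination (N r k : ℕ) (T : sector H k →L[ℂ] sector H k) : Prop :=
  ∃ (m : ℕ) (α : Fin m → ℝ) (S : Fin m → (sector H k →L[ℂ] sector H k)),
    (∀ j, 0 ≤ α j) ∧ ((∑ j, α j : ℝ) : ℂ) = trace T ∧
    (∀ j, IsState (S j) ∧ stateRank (extendByZero k (S j)) + N ≤ r + k) ∧
    T = ∑ j, (α j : ℂ) • S j

end States

end Fermi

/-!
The proof reduces both parts to explicit Kraus operators on a finite-dimensional Fock space.

*Finite dimension.* A state `Γ` has only particles in a subspace `E` when `a(g) Γ = 0` for all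
`g ⟂ E` (`SupportedIn`). As `tr (Γ a†(g) a(g)) = 0` forces `a(g) Γ = 0` (`IsState.comp_eq_zero`),
this can be read off the one-body density matrix. Hence a state of rank at most `r` has its
particles in some `E` of dimension at most `r`, its `B`-localizations have theirs in `B E`, and all
these operators have finite rank, so that their traces are finite sums and cyclic.

*Second quantization.* For `B` on `H` let `V` be the operator with
`V (f₁ ∧ ⋯ ∧ fₙ) = B f₁ ∧ ⋯ ∧ B fₙ`. If `V` belongs to `B`, then `V + a†(u) V a(v)` belongs to
`B + |u⟩⟨v|` (`IsSecondQuantization.add_rankOne`). This identity carries most of the argument. It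
gives the second quantization of finite rank operators; it gives the normal ordered expansion of the
vacuum projection, hence the uniqueness of a state with given density matrices
(`eq_zero_of_densityMatrix`); and it gives the localization itself, as follows.

*Existence and ranks.* Let `P` be the projection on `E`, and diagonalise
`P (1 - B† B) P = ∑ μᵢ |eᵢ⟩⟨eᵢ|` with the `eᵢ` in `E` and `μᵢ ≥ 0`. Applying the maps
`X ↦ X + μᵢ a(eᵢ) X a†(eᵢ)` to `Γ` one after the other, and then conjugating by the second
quantization of `B P`, produces a positive operator. Its moments are those of `Γ` with the second
quantization of `(BP)† BP + ∑ μᵢ |eᵢ⟩⟨eᵢ| = P` inserted in the middle, which is harmless, so it is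
the localization (`IsPiece.exists_attenuation`, `IsPiece.exists_localization`). Moving `a(eᵢ)`
through the products costs signs which cancel when `p + q` is even; for `p + q` odd both density
matrices vanish by parity. Each `a(eᵢ)` lowers both the particle number and the dimension of the
one-body space by one, which is the bound `r - N + k` on the ranks (`IsPiece`).

*Geometric limits.* The states `Γₙ` have particles in spaces `Eₙ` of dimension at most `r`. Partial
isometries `Cₙ` carry `Eₙ` into one space `F` and `Γₙ` to states `Γ'ₙ` with particles in `F`. Along
an ultrafilter `Cₙ → C` pointwise and `Γ'ₙ → Γ'`, everything taking place in finite dimension. The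
limit `Γ` is then the `C†`-localization of `Γ'` (`exists_isLocalization_of_geomTendsto`), and the
second part follows from the first.
-/

namespace Fermi

open InnerProductSpace

universe u

/-! ### Traces, states and finite rank operators -/

section Trace

variable {X Y : Type u} [NormedAddCommGroup X] [InnerProductSpace ℂ X]
  [NormedAddCommGroup Y] [InnerProductSpace ℂ Y]

/-- `T` has trace `c`: in every Hilbert basis the sum of the diagonal elements of `T` converges
to `c`. The index types are those quantified over in `IsState`, so that a state is a positive
operator with `HasTrace T 1`. -/
def HasTrace (T : X →L[ℂ] X) (c : ℂ) : Prop :=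
  ∀ (κ : Type u) (b : HilbertBasis κ ℂ X), HasSum (fun i => ⟪b i, T (b i)⟫_ℂ) c

theorem HasTrace.trace_eq [CompleteSpace X] {T : X →L[ℂ] X} {c : ℂ} (h : HasTrace T c) :
    trace T = c := by
  obtain ⟨b, hb⟩ := (exists_hilbertBasis ℂ X).choose_spec
  have := h _ b
  rw [hb] at this
  exact this.tsum_eq

theorem HasTrace.zero : HasTrace (0 : X →L[ℂ] X) 0 := fun κ b => by simp [hasSum_zero]

theorem HasTrace.add {S T : X →L[ℂ] X} {c d : ℂ} (hS : HasTrace S c) (hT : HasTrace T d) :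
    HasTrace (S + T) (c + d) := fun κ b => by
  simpa [inner_add_right] using (hS κ b).add (hT κ b)

theorem HasTrace.smul {T : X →L[ℂ] X} {d : ℂ} (c : ℂ) (hT : HasTrace T d) :
    HasTrace (c • T) (c * d) := fun κ b => by
  simpa [inner_smul_right] using (hT κ b).mul_left c

theorem HasTrace.sum {ι : Type*} (s : Finset ι) {T : ι → X →L[ℂ] X} {c : ι → ℂ}
    (h : ∀ i ∈ s, HasTrace (T i) (c i)) : HasTrace (∑ i ∈ s, T i) (∑ i ∈ s, c i) := fun κ b => by
  simpa [sum_apply, inner_sum] using hasSum_sum fun i hi => h i hi κ b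

theorem hasTrace_rankOne (u v : X) : HasTrace (rankOne ℂ u v) ⟪v, u⟫_ℂ := fun κ b => by
  simpa [inner_smul_right] using b.hasSum_inner_mul_inner v u

theorem _root_.HilbertBasis.hasSum_norm_inner_sq {κ : Type*} (b : HilbertBasis κ ℂ X) (y : X) :
    HasSum (fun j => ‖⟪y, b j⟫_ℂ‖ ^ 2) (‖y‖ ^ 2) := by
  have h := (b.hasSum_inner_mul_inner y y).mapL Complex.reCLM
  have e1 : ∀ j, Complex.reCLM (⟪y, b j⟫_ℂ * ⟪b j, y⟫_ℂ) = ‖⟪y, b j⟫_ℂ‖ ^ 2 := fun j => by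
    rw [← inner_conj_symm (b j) y, Complex.reCLM_apply, Complex.mul_conj,
      Complex.ofReal_re, Complex.normSq_eq_norm_sq]
  have e2 : Complex.reCLM ⟪y, y⟫_ℂ = ‖y‖ ^ 2 := by
    rw [Complex.reCLM_apply, inner_self_eq_norm_sq_to_K]
    norm_cast
  simp only [e1, e2] at h
  exact h

/-- If `∑ ‖v i‖² < ∞`, the matrix elements of `D v` in a Hilbert basis are square summable. With
`v i = R† (d i)` this says that Hilbert–Schmidt operators have square summable matrices. -/
theorem summable_norm_inner_sq {κ ι : Type*} (b : HilbertBasis ι ℂ X) {v : κ → X}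
    (hv : Summable fun i => ‖v i‖ ^ 2) (D : X →L[ℂ] X) :
    Summable fun p : κ × ι => ‖⟪D (v p.1), b p.2⟫_ℂ‖ ^ 2 := by
  refine (summable_prod_of_nonneg fun p => sq_nonneg _).2
    ⟨fun i => (b.hasSum_norm_inner_sq (D (v i))).summable, ?_⟩
  have e : ∀ i, ∑' j, ‖⟪D (v i), b j⟫_ℂ‖ ^ 2 = ‖D (v i)‖ ^ 2 := fun i =>
    (b.hasSum_norm_inner_sq _).tsum_eq
  simp only [e]
  have hle : ∀ i, ‖D (v i)‖ ^ 2 ≤ ‖D‖ ^ 2 * ‖v i‖ ^ 2 := fun i => by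
    rw [← mul_pow]
    exact pow_le_pow_left₀ (norm_nonneg _) (D.le_opNorm _) 2
  exact Summable.of_nonneg_of_le (fun i => sq_nonneg _) hle (hv.mul_left (‖D‖ ^ 2))

/-- The trace of a positive operator `R† R` against `A† A`. It rests on the exchange of the two
Hilbert bases in the double series `∑ ⟪R b, d⟫ ⟪d, R A† A b⟫`. -/
theorem hasTrace_adjoint_mul [CompleteSpace X] [CompleteSpace Y] {R : X →L[ℂ] Y} {κ : Type u}
    (d : HilbertBasis κ ℂ Y) (hR : Summable fun i => ‖R.adjoint (d i)‖ ^ 2) (A : X →L[ℂ] X) :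
    HasTrace (R.adjoint ∘L R ∘L A.adjoint ∘L A)
      (∑' i, ((‖A (R.adjoint (d i))‖ ^ 2 : ℝ) : ℂ)) := by
  intro ι b
  obtain ⟨v, hv⟩ : ∃ v : κ → X, ∀ i, v i = R.adjoint (d i) := ⟨_, fun _ => rfl⟩
  obtain ⟨C, hC⟩ : ∃ C : X →L[ℂ] X, C = A.adjoint ∘L A := ⟨_, rfl⟩
  simp only [← hv] at hR ⊢
  have hs : Summable fun p : κ × ι => ⟪C (v p.1), b p.2⟫_ℂ * ⟪b p.2, v p.1⟫_ℂ := by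
    refine Summable.of_norm_bounded ((summable_norm_inner_sq b hR C).add
      (summable_norm_inner_sq b hR 1)) fun p => ?_
    rw [norm_mul, norm_inner_symm (b p.2), one_apply_eq_self]
    generalize ‖⟪C (v p.1), b p.2⟫_ℂ‖ = s
    generalize ‖⟪v p.1, b p.2⟫_ℂ‖ = t
    nlinarith [sq_nonneg (s - t), sq_nonneg s, sq_nonneg t]
  have hrow : ∀ i, HasSum (fun j => ⟪C (v i), b j⟫_ℂ * ⟪b j, v i⟫_ℂ)
      (((‖A (v i)‖ ^ 2 : ℝ) : ℂ)) := by
    intro i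
    have h := b.hasSum_inner_mul_inner (C (v i)) (v i)
    have e : ⟪C (v i), v i⟫_ℂ = ((‖A (v i)‖ ^ 2 : ℝ) : ℂ) := by
      rw [hC, ContinuousLinearMap.comp_apply, ContinuousLinearMap.adjoint_inner_left,
        inner_self_eq_norm_sq_to_K]
      norm_cast
    rwa [e] at h
  have hcol : ∀ j, HasSum (fun i => ⟪C (v i), b j⟫_ℂ * ⟪b j, v i⟫_ℂ)
      ⟪b j, (R.adjoint ∘L R ∘L A.adjoint ∘L A) (b j)⟫_ℂ := by
    intro j
    have h := d.hasSum_inner_mul_inner (R (b j)) (R (C (b j)))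
    have e1 : ⟪b j, (R.adjoint ∘L R ∘L A.adjoint ∘L A) (b j)⟫_ℂ = ⟪R (b j), R (C (b j))⟫_ℂ := by
      rw [← ContinuousLinearMap.adjoint_inner_right, hC]
      rfl
    have hCa : C.adjoint = C := by
      rw [hC, ContinuousLinearMap.adjoint_comp, ContinuousLinearMap.adjoint_adjoint]
    have e2 : ∀ i, ⟪R (b j), d i⟫_ℂ * ⟪d i, R (C (b j))⟫_ℂ =
        ⟪C (v i), b j⟫_ℂ * ⟪b j, v i⟫_ℂ := by
      intro i
      rw [mul_comm, ← ContinuousLinearMap.adjoint_inner_right, ← hv,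
        ← ContinuousLinearMap.adjoint_inner_left R, ← hv,
        ← ContinuousLinearMap.adjoint_inner_left C, hCa]
    rw [e1]
    simpa only [e2] using h
  have h2 := hs.hasSum
  have h3 := h2.prod_fiberwise hrow
  rw [h3.tsum_eq]
  exact ((Equiv.prodComm ι κ).hasSum_iff.2 h2).prod_fiberwise hcol

theorem _root_.ContinuousLinearMap.IsPositive.exists_sqrt [CompleteSpace X] {T : X →L[ℂ] X}
    (hT : T.IsPositive) : ∃ S : X →L[ℂ] X, S.adjoint = S ∧ S ∘L S = T := by
  have h0 := (ContinuousLinearMap.nonneg_iff_isPositive T).2 hT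
  refine ⟨CFC.sqrt T, ?_, CFC.sqrt_mul_sqrt_self T h0⟩
  exact ((ContinuousLinearMap.nonneg_iff_isPositive _).1 (CFC.sqrt_nonneg T)).isSelfAdjoint

/-- The square root `S` of a positive operator of trace `c` has Hilbert–Schmidt norm squared `c`. -/
theorem HasTrace.hasSum_norm_sq [CompleteSpace X] {T S : X →L[ℂ] X} {c : ℝ} (hT : HasTrace T c)
    (hS : S.adjoint = S) (hST : S ∘L S = T) {κ : Type u} (b : HilbertBasis κ ℂ X) :
    HasSum (fun i => ‖S (b i)‖ ^ 2) c := by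
  have h := hT κ b
  have e : ∀ i, ⟪b i, T (b i)⟫_ℂ = ((‖S (b i)‖ ^ 2 : ℝ) : ℂ) := fun i => by
    rw [← hST, ContinuousLinearMap.comp_apply, ← ContinuousLinearMap.adjoint_inner_left, hS,
      inner_self_eq_norm_sq_to_K]
    norm_cast
  simp only [e] at h
  exact_mod_cast h

/-- If the expectation of `A† A` in the state `T` vanishes then so does `A T`. -/
theorem IsState.comp_eq_zero [CompleteSpace X] {T : X →L[ℂ] X} (hT : IsState T) {A : X →L[ℂ] X}
    (h : trace (T * (A.adjoint * A)) = 0) : A * T = 0 := by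
  obtain ⟨S, hS, hST⟩ := hT.1.exists_sqrt
  obtain ⟨w, b, -⟩ := exists_hilbertBasis ℂ X
  have hsum := HasTrace.hasSum_norm_sq (c := 1) (by rw [Complex.ofReal_one]; exact hT.2) hS hST b
  have h1 := hasTrace_adjoint_mul (R := S) b (by rw [hS]; exact hsum.summable) A
  have hle : ∀ i, ‖A (S (b i))‖ ^ 2 ≤ ‖A‖ ^ 2 * ‖S (b i)‖ ^ 2 := fun i => by
    rw [← mul_pow]
    exact pow_le_pow_left₀ (norm_nonneg _) (A.le_opNorm _) 2
  have h2 : Summable fun i => ‖A (S (b i))‖ ^ 2 :=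
    Summable.of_nonneg_of_le (fun i => sq_nonneg _) hle (hsum.summable.mul_left (‖A‖ ^ 2))
  have h3 : T * (A.adjoint * A) = S.adjoint ∘L S ∘L A.adjoint ∘L A := by
    rw [hS, ← hST]; rfl
  rw [h3, h1.trace_eq, hS, ← Complex.ofReal_tsum, Complex.ofReal_eq_zero] at h
  have h4 := (hasSum_zero_iff_of_nonneg fun i => sq_nonneg _).1 (h ▸ h2.hasSum)
  have h5 : A ∘L S = 0 := by
    refine ContinuousLinearMap.ext_on
      (Submodule.dense_iff_topologicalClosure_eq_top.2 b.dense_span) ?_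
    rintro _ ⟨i, rfl⟩
    simpa using congrFun h4 i
  rw [← hST]
  exact congrArg (fun Z => Z ∘L S) h5

theorem IsState.norm_apply_le [CompleteSpace X] {T : X →L[ℂ] X} (hT : IsState T) (x : X) :
    ‖T x‖ ≤ ‖x‖ := by
  obtain ⟨S, hS, hST⟩ := hT.1.exists_sqrt
  obtain ⟨w, b, -⟩ := exists_hilbertBasis ℂ X
  have hsum := HasTrace.hasSum_norm_sq (c := 1) (by rw [Complex.ofReal_one]; exact hT.2) hS hST b
  have h : ∀ y, ‖S y‖ ≤ ‖y‖ := by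
    intro y
    refine le_of_sq_le_sq ?_ (norm_nonneg y)
    have h1 := b.hasSum_norm_inner_sq (S y)
    have h2 := hsum.mul_left (‖y‖ ^ 2)
    rw [mul_one] at h2
    refine hasSum_le (fun i => ?_) h1 h2
    rw [← ContinuousLinearMap.adjoint_inner_right, hS, ← mul_pow]
    exact pow_le_pow_left₀ (norm_nonneg _) (norm_inner_le_norm _ _) 2
  rw [← hST]
  exact (h _).trans (h x)

/-- A state on a closed subspace, extended by zero, is a state. -/
theorem IsState.conj_subtype [CompleteSpace X] {K : Submodule ℂ X} [CompleteSpace K]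
    {T : K →L[ℂ] K} (hT : IsState T) :
    IsState (K.subtypeL ∘L T ∘L K.orthogonalProjectionOnto) := by
  obtain ⟨S, hS, hST⟩ := hT.1.exists_sqrt
  obtain ⟨w, b, -⟩ := exists_hilbertBasis ℂ K
  have hsum := HasTrace.hasSum_norm_sq (c := 1) (by rw [Complex.ofReal_one]; exact hT.2) hS hST b
  have hadj : (S ∘L K.orthogonalProjectionOnto).adjoint = K.subtypeL ∘L S := by
    rw [ContinuousLinearMap.adjoint_comp, hS, Submodule.adjoint_orthogonalProjectionOnto]
  have hn : ∀ i, ‖(S ∘L K.orthogonalProjectionOnto).adjoint (b i)‖ ^ 2 = ‖S (b i)‖ ^ 2 := by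
    intro i
    rw [hadj]; rfl
  have h1 := hasTrace_adjoint_mul (R := S ∘L K.orthogonalProjectionOnto) b
    (by simpa only [hn] using hsum.summable) (1 : X →L[ℂ] X)
  simp only [one_apply_eq_self, hn] at h1
  have e1 : (S ∘L K.orthogonalProjectionOnto).adjoint ∘L (S ∘L K.orthogonalProjectionOnto) =
      K.subtypeL ∘L T ∘L K.orthogonalProjectionOnto := by
    rw [hadj, ← hST]; rfl
  have e2 : (S ∘L K.orthogonalProjectionOnto).adjoint ∘L (S ∘L K.orthogonalProjectionOnto) ∘L
      (1 : X →L[ℂ] X).adjoint ∘L (1 : X →L[ℂ] X) = K.subtypeL ∘L T ∘L K.orthogonalProjectionOnto := by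
    rw [← e1]
    ext x
    simp [ContinuousLinearMap.one_def, ContinuousLinearMap.adjoint_id]
  rw [e2, ← Complex.ofReal_tsum, hsum.tsum_eq, Complex.ofReal_one] at h1
  refine ⟨?_, h1⟩
  rw [← e1]
  exact ContinuousLinearMap.isPositive_adjoint_comp_self _

/-- Finite rank operators, as finite sums of operators `|u⟩⟨v|`. -/
def HasFiniteRank (T : X →L[ℂ] X) : Prop :=
  ∃ (n : ℕ) (u v : Fin n → X), T = ∑ j, rankOne ℂ (u j) (v j)

theorem HasFiniteRank.zero : HasFiniteRank (0 : X →L[ℂ] X) := ⟨0, Fin.elim0, Fin.elim0, by simp⟩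

theorem hasFiniteRank_rankOne (u v : X) : HasFiniteRank (rankOne ℂ u v) :=
  ⟨1, fun _ => u, fun _ => v, by simp⟩

theorem HasFiniteRank.add {S T : X →L[ℂ] X} (hS : HasFiniteRank S) (hT : HasFiniteRank T) :
    HasFiniteRank (S + T) := by
  obtain ⟨n, u, v, rfl⟩ := hS
  obtain ⟨m, u', v', rfl⟩ := hT
  exact ⟨n + m, Fin.append u u', Fin.append v v', by simp [Fin.sum_univ_add]⟩

theorem HasFiniteRank.mul_left {T : X →L[ℂ] X} (hT : HasFiniteRank T) (C : X →L[ℂ] X) :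
    HasFiniteRank (C * T) := by
  obtain ⟨n, u, v, rfl⟩ := hT
  refine ⟨n, fun j => C (u j), v, ?_⟩
  rw [Finset.mul_sum]
  exact Finset.sum_congr rfl fun j _ => comp_rankOne _ _ _

theorem HasFiniteRank.mul_right [CompleteSpace X] {T : X →L[ℂ] X} (hT : HasFiniteRank T)
    (C : X →L[ℂ] X) : HasFiniteRank (T * C) := by
  obtain ⟨n, u, v, rfl⟩ := hT
  refine ⟨n, u, fun j => C.adjoint (v j), ?_⟩
  rw [Finset.sum_mul]
  exact Finset.sum_congr rfl fun j _ => rankOne_comp _ _ _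

theorem HasFiniteRank.smul {T : X →L[ℂ] X} (hT : HasFiniteRank T) (c : ℂ) :
    HasFiniteRank (c • T) := by
  simpa using hT.mul_left (c • (1 : X →L[ℂ] X))

theorem HasFiniteRank.hasTrace [CompleteSpace X] {T : X →L[ℂ] X} (hT : HasFiniteRank T) :
    HasTrace T (trace T) := by
  obtain ⟨n, u, v, rfl⟩ := hT
  have h := HasTrace.sum Finset.univ fun j _ => hasTrace_rankOne (u j) (v j)
  rwa [h.trace_eq]

theorem trace_add [CompleteSpace X] {S T : X →L[ℂ] X} (hS : HasFiniteRank S)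
    (hT : HasFiniteRank T) : trace (S + T) = trace S + trace T :=
  (hS.hasTrace.add hT.hasTrace).trace_eq

theorem trace_smul [CompleteSpace X] {T : X →L[ℂ] X} (hT : HasFiniteRank T) (c : ℂ) :
    trace (c • T) = c * trace T :=
  (hT.hasTrace.smul c).trace_eq

theorem trace_sub [CompleteSpace X] {S T : X →L[ℂ] X} (hS : HasFiniteRank S)
    (hT : HasFiniteRank T) : trace (S - T) = trace S - trace T := by
  rw [sub_eq_add_neg, ← neg_one_smul ℂ, trace_add hS (hT.smul _), trace_smul hT]
  ring

theorem trace_rankOne [CompleteSpace X] (u v : X) : trace (rankOne ℂ u v) = ⟪v, u⟫_ℂ :=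
  (hasTrace_rankOne u v).trace_eq

theorem trace_mul_comm [CompleteSpace X] {T : X →L[ℂ] X} (hT : HasFiniteRank T)
    (C : X →L[ℂ] X) : trace (T * C) = trace (C * T) := by
  obtain ⟨n, u, v, rfl⟩ := hT
  have h1 := HasTrace.sum Finset.univ fun j _ => hasTrace_rankOne (u j) (C.adjoint (v j))
  have h2 := HasTrace.sum Finset.univ fun j _ => hasTrace_rankOne (C (u j)) (v j)
  rw [Finset.sum_mul, Finset.mul_sum]
  simp only [ContinuousLinearMap.mul_def, rankOne_comp, comp_rankOne]
  rw [h1.trace_eq, h2.trace_eq]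
  simp [ContinuousLinearMap.adjoint_inner_left]

theorem HasFiniteRank.exists_finiteDimensional {T : X →L[ℂ] X} (hT : HasFiniteRank T) :
    ∃ L : Submodule ℂ X, FiniteDimensional ℂ L ∧ ∀ x, T x ∈ L := by
  obtain ⟨n, u, v, rfl⟩ := hT
  refine ⟨Submodule.span ℂ (Set.range u),
    FiniteDimensional.span_of_finite ℂ (Set.finite_range u), fun x => ?_⟩
  rw [sum_apply]
  exact Submodule.sum_mem _ fun j _ =>
    Submodule.smul_mem _ _ (Submodule.subset_span (Set.mem_range_self j))

/-- An operator with values in a finite-dimensional space `L`, expanded in an orthonormal basis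
of `L`. -/
theorem eq_sum_rankOne_of_mem [CompleteSpace X] {L : Submodule ℂ X} {ι : Type*} [Fintype ι]
    (w : OrthonormalBasis ι ℂ L) {T : X →L[ℂ] X} (hT : ∀ x, T x ∈ L) :
    T = ∑ j, rankOne ℂ (w j : X) (T.adjoint (w j)) := by
  ext x
  have h := congrArg (Subtype.val) (w.sum_repr' ⟨T x, hT x⟩)
  simp only [Submodule.coe_sum, Submodule.coe_smul, Submodule.coe_inner] at h
  simp [ContinuousLinearMap.adjoint_inner_left, h]

theorem trace_eq_sum_of_mem [CompleteSpace X] {L : Submodule ℂ X} {ι : Type*} [Fintype ι]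
    (w : OrthonormalBasis ι ℂ L) {T : X →L[ℂ] X} (hT : ∀ x, T x ∈ L) :
    trace T = ∑ j, ⟪(w j : X), T (w j)⟫_ℂ := by
  have h := HasTrace.sum Finset.univ fun j _ => hasTrace_rankOne (w j : X) (T.adjoint (w j))
  rw [← eq_sum_rankOne_of_mem w hT] at h
  rw [h.trace_eq]
  simp [ContinuousLinearMap.adjoint_inner_left]

end Trace

/-! ### Second quantization -/

section SecondQuantization

variable {H : Type u} [NormedAddCommGroup H] [InnerProductSpace ℂ H]

theorem denseRange_toFock : DenseRange (toFock : ExteriorAlgebra ℂ H → Fock H) :=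
  UniformSpace.Completion.denseRange_coe (α := AlgFock H)

theorem toFock_add (x y : ExteriorAlgebra ℂ H) : toFock (x + y) = toFock x + toFock y :=
  UniformSpace.Completion.coe_add (α := AlgFock H) x y

theorem toFock_smul (c : ℂ) (x : ExteriorAlgebra ℂ H) : toFock (c • x) = c • toFock x :=
  UniformSpace.Completion.coe_smul (X := AlgFock H) c x

theorem toFock_zero : toFock (0 : ExteriorAlgebra ℂ H) = 0 :=
  UniformSpace.Completion.coe_zero (α := AlgFock H)

theorem toFock_sum {κ : Type*} (s : Finset κ) (x : κ → ExteriorAlgebra ℂ H) :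
    toFock (∑ i ∈ s, x i) = ∑ i ∈ s, toFock (x i) := by
  classical
  induction s using Finset.induction_on with
  | empty => simp [toFock_zero]
  | insert i s hi ih => rw [Finset.sum_insert hi, Finset.sum_insert hi, toFock_add, ih]

theorem exterior_induction {p : ExteriorAlgebra ℂ H → Prop}
    (h0 : ∀ c, p (algebraMap ℂ _ c)) (hadd : ∀ x y, p x → p y → p (x + y))
    (hmul : ∀ f x, p x → p (ExteriorAlgebra.ι ℂ f * x)) (x : ExteriorAlgebra ℂ H) : p x := by
  induction x using CliffordAlgebra.left_induction with
  | algebraMap c => exact h0 c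
  | add x y hx hy => exact hadd x y hx hy
  | ι_mul x f hx => exact hmul f x hx

theorem fock_ext {φ ψ : Fock H} (h : ∀ x, ⟪toFock x, φ⟫_ℂ = ⟪toFock x, ψ⟫_ℂ) : φ = ψ := by
  refine ext_inner_left ℂ fun v => ?_
  exact denseRange_toFock.induction_on (p := fun v => ⟪v, φ⟫_ℂ = ⟪v, ψ⟫_ℂ) v
    (isClosed_eq (by fun_prop) (by fun_prop)) h

theorem fock_clm_ext {S T : Fock H →L[ℂ] Fock H} (h : ∀ x, S (toFock x) = T (toFock x)) :
    S = T :=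
  ContinuousLinearMap.coeFn_injective <| denseRange_toFock.equalizer S.continuous T.continuous
    (funext h)

/-- The vacuum vector. -/
noncomputable def vacuum : Fock H := toFock 1

theorem annihilate_toFock (f : H) (x : ExteriorAlgebra ℂ H) :
    annihilate f (toFock x) = toFock (contract f x) := by
  refine fock_ext fun y => ?_
  rw [annihilate, ContinuousLinearMap.adjoint_inner_right, create_toFock, inner_toFock,
    inner_toFock, fockForm_ι_mul_left]

theorem adjoint_annihilate (f : H) : (annihilate f).adjoint = create f :=
  ContinuousLinearMap.adjoint_adjoint _

theorem create_add (f g : H) : create (f + g) = create f + create g :=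
  fock_clm_ext fun x => by simp [create_toFock, add_mul, toFock_add]

theorem create_smul (c : ℂ) (f : H) : create (c • f) = c • create f :=
  fock_clm_ext fun x => by simp [create_toFock, toFock_smul]

theorem annihilate_add (f g : H) : annihilate (f + g) = annihilate f + annihilate g := by
  simp [annihilate, create_add]

theorem annihilate_smul (c : ℂ) (f : H) : annihilate (c • f) = conj c • annihilate f := by
  rw [annihilate, create_smul, map_smulₛₗ]
  rfl

theorem create_zero : create (0 : H) = 0 := by simpa using create_smul (0 : ℂ) (0 : H)

theorem create_mul_create (f g : H) : create f * create g = -(create g * create f) := by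
  refine fock_clm_ext fun x => ?_
  have h := ExteriorAlgebra.ι_add_mul_swap (R := ℂ) f g
  simp only [ContinuousLinearMap.mul_def, ContinuousLinearMap.comp_apply, neg_apply,
    create_toFock, ← mul_assoc]
  rw [eq_neg_of_add_eq_zero_left h, neg_mul, ← neg_one_smul ℂ, toFock_smul, neg_one_smul]

theorem annihilate_mul_annihilate (f g : H) :
    annihilate f * annihilate g = -(annihilate g * annihilate f) := by
  have h := congrArg ContinuousLinearMap.adjoint (create_mul_create g f)
  rw [map_neg, ContinuousLinearMap.mul_def, ContinuousLinearMap.mul_def,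
    ContinuousLinearMap.adjoint_comp, ContinuousLinearMap.adjoint_comp] at h
  exact h

theorem annihilate_mul_self (f : H) : annihilate f * annihilate f = 0 := by
  have h : (2 : ℂ) • (annihilate f * annihilate f) = 0 := by
    rw [two_smul]
    nth_rewrite 1 [annihilate_mul_annihilate f f]
    exact neg_add_cancel _
  exact (smul_eq_zero.1 h).resolve_left two_ne_zero

theorem norm_create_le (f : H) : ‖create f‖ ≤ ‖f‖ := by
  refine ContinuousLinearMap.opNorm_le_bound _ (norm_nonneg _) fun v => ?_
  refine denseRange_toFock.induction_on (p := fun v => ‖create f v‖ ≤ ‖f‖ * ‖v‖) v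
    (isClosed_le (by fun_prop) (by fun_prop)) fun x => ?_
  have h : ∀ z : AlgFock H, ‖algCreate f z‖ ≤ ‖f‖ * ‖z‖ := fun z =>
    (algCreate f).le_of_opNorm_le (LinearMap.mkContinuous_norm_le _ (norm_nonneg f) _) z
  have e1 := UniformSpace.Completion.norm_coe (E := AlgFock H) x
  have e2 := UniformSpace.Completion.norm_coe (E := AlgFock H) (algCreate f x)
  have e3 := ContinuousLinearMap.completion_apply_coe (algCreate f) (x : AlgFock H)
  exact (congrArg norm e3).trans_le (e2.trans_le ((h x).trans_eq (congrArg (‖f‖ * ·) e1.symm)))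

theorem continuous_create : Continuous (create : H → Fock H →L[ℂ] Fock H) := by
  let L : H →ₗ[ℂ] Fock H →L[ℂ] Fock H :=
    { toFun := create, map_add' := create_add, map_smul' := create_smul }
  exact (L.mkContinuous 1 fun f => (norm_create_le f).trans_eq (one_mul _).symm).continuous

/-- `V` is the second quantization of `B`: `V (f₁ ∧ ⋯ ∧ fₙ) = B f₁ ∧ ⋯ ∧ B fₙ` for all `n`. As a
relation it also makes sense for operators `B` of norm larger than one, for which a bounded `V`
exists only in special cases. -/
def IsSecondQuantization (B : H →L[ℂ] H) (V : Fock H →L[ℂ] Fock H) : Prop :=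
  ∀ x, V (toFock x) = toFock (ExteriorAlgebra.map (B : H →ₗ[ℂ] H) x)

theorem map_ι_mul (B : H →L[ℂ] H) (f : H) (x : ExteriorAlgebra ℂ H) :
    ExteriorAlgebra.map (B : H →ₗ[ℂ] H) (ExteriorAlgebra.ι ℂ f * x) =
      ExteriorAlgebra.ι ℂ (B f) * ExteriorAlgebra.map (B : H →ₗ[ℂ] H) x := by
  rw [map_mul, ExteriorAlgebra.map_apply_ι]
  rfl

theorem map_algebraMap (B : H →L[ℂ] H) (c : ℂ) :
    ExteriorAlgebra.map (B : H →ₗ[ℂ] H) (algebraMap ℂ _ c) = algebraMap ℂ _ c :=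
  AlgHom.commutes _ c

theorem algebraMapInv_map (B : H →L[ℂ] H) (x : ExteriorAlgebra ℂ H) :
    ExteriorAlgebra.algebraMapInv (ExteriorAlgebra.map (B : H →ₗ[ℂ] H) x) =
      ExteriorAlgebra.algebraMapInv x := by
  have : (ExteriorAlgebra.algebraMapInv (R := ℂ) (M := H)).comp
      (ExteriorAlgebra.map (B : H →ₗ[ℂ] H)) = ExteriorAlgebra.algebraMapInv := by
    ext f
    simp [ExteriorAlgebra.algebraMapInv]
  exact DFunLike.congr_fun this x

theorem fockForm_one_left (x : ExteriorAlgebra ℂ H) :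
    fockForm 1 x = ExteriorAlgebra.algebraMapInv x := by
  rw [← fockForm_symm, ← map_one (algebraMap ℂ (ExteriorAlgebra ℂ H)), fockForm_algebraMap]
  simp

namespace IsSecondQuantization

variable {B B' : H →L[ℂ] H} {V V' : Fock H →L[ℂ] Fock H}

theorem unique (h : IsSecondQuantization B V) (h' : IsSecondQuantization B V') : V = V' :=
  fock_clm_ext fun x => by rw [h, h']

theorem mul (h : IsSecondQuantization B V) (h' : IsSecondQuantization B' V') :
    IsSecondQuantization (B * B') (V * V') := fun x => by
  have e : ((B * B' : H →L[ℂ] H) : H →ₗ[ℂ] H) = (B : H →ₗ[ℂ] H) ∘ₗ B' := rfl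
  rw [ContinuousLinearMap.mul_def, ContinuousLinearMap.comp_apply, h', h, e,
    ← ExteriorAlgebra.map_comp_map]
  rfl

theorem mul_create (h : IsSecondQuantization B V) (f : H) :
    V * create f = create (B f) * V := fock_clm_ext fun x => by
  simp only [ContinuousLinearMap.mul_def, ContinuousLinearMap.comp_apply, create_toFock, h x, h _,
    map_ι_mul]

theorem apply_vacuum (h : IsSecondQuantization B V) : V vacuum = vacuum := by
  rw [vacuum, h, map_one]

theorem apply_wedge (h : IsSecondQuantization B V) {n : ℕ} (f : Fin n → H) :
    V (wedge f) = wedge fun i => B (f i) := by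
  rw [wedge, h, ExteriorAlgebra.map_apply_ιMulti]
  rfl

/-- Second quantization of a rank one perturbation: as `u ∧ u = 0`, at most one factor of
`(B + |u⟩⟨v|) f₁ ∧ ⋯ ∧ (B + |u⟩⟨v|) fₙ` can contribute its rank one part. -/
theorem add_rankOne (h : IsSecondQuantization B V) (u v : H) :
    IsSecondQuantization (B + rankOne ℂ u v) (V + create u * V * annihilate v) := by
  intro x
  have key : ExteriorAlgebra.map ((B + rankOne ℂ u v : H →L[ℂ] H) : H →ₗ[ℂ] H) x =
      ExteriorAlgebra.map (B : H →ₗ[ℂ] H) x +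
        ExteriorAlgebra.ι ℂ u * ExteriorAlgebra.map (B : H →ₗ[ℂ] H) (contract v x) := by
    induction x using exterior_induction with
    | h0 c => rw [contract_algebraMap, map_algebraMap, map_algebraMap, map_zero, mul_zero, add_zero]
    | hadd x y hx hy =>
      rw [map_add, hx, hy, map_add, map_add, map_add, mul_add]
      abel
    | hmul f x hx =>
      have hBf : (B + rankOne ℂ u v) f = B f + ⟪v, f⟫_ℂ • u := rfl
      have hsw := eq_neg_of_add_eq_zero_left (ExteriorAlgebra.ι_add_mul_swap (R := ℂ) u (B f))
      have hsq := ExteriorAlgebra.ι_sq_zero (R := ℂ) u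
      rw [map_ι_mul, hx, contract_ι_mul, map_sub, map_smul, map_ι_mul, map_ι_mul, hBf, map_add,
        map_smul]
      generalize ExteriorAlgebra.map (B : H →ₗ[ℂ] H) x = y
      generalize ExteriorAlgebra.map (B : H →ₗ[ℂ] H) (contract v x) = z
      rw [mul_add, add_mul, add_mul, mul_sub, mul_smul_comm, smul_mul_assoc, smul_mul_assoc,
        ← mul_assoc (ExteriorAlgebra.ι ℂ u), ← mul_assoc (ExteriorAlgebra.ι ℂ u), hsq, zero_mul,
        smul_zero, hsw, neg_mul, mul_assoc]
      abel
  rw [key, toFock_add, ← h, ← create_toFock, ← h, ← annihilate_toFock]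
  rfl

end IsSecondQuantization

/-- The second quantization of `0` is the projection on the vacuum. -/
theorem isSecondQuantization_zero :
    IsSecondQuantization (0 : H →L[ℂ] H) (rankOne ℂ vacuum vacuum) := by
  intro x
  have h : ExteriorAlgebra.map ((0 : H →L[ℂ] H) : H →ₗ[ℂ] H) =
      (Algebra.ofId ℂ _).comp ExteriorAlgebra.algebraMapInv := by
    ext f
    simp [ExteriorAlgebra.algebraMapInv]
  have e : ExteriorAlgebra.map ((0 : H →L[ℂ] H) : H →ₗ[ℂ] H) x =
      ExteriorAlgebra.algebraMapInv (R := ℂ) x • 1 := by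
    rw [h, Algebra.smul_def, mul_one]
    rfl
  rw [rankOne_apply, vacuum, inner_toFock, fockForm_one_left, ← toFock_smul, e]

theorem exists_isSecondQuantization_add_sum {B : H →L[ℂ] H} {V : Fock H →L[ℂ] Fock H}
    (h : IsSecondQuantization B V) (hV : HasFiniteRank V) {ι : Type*} (s : Finset ι) (u v : ι → H) :
    ∃ W, IsSecondQuantization (B + ∑ i ∈ s, rankOne ℂ (u i) (v i)) W ∧ HasFiniteRank W := by
  classical
  induction s using Finset.induction_on with
  | empty => exact ⟨V, by simpa using h, hV⟩
  | insert i s hi ih =>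
    obtain ⟨W, hW, hf⟩ := ih
    refine ⟨_, ?_, hf.add ((hf.mul_left (create (u i))).mul_right (annihilate (v i)))⟩
    rw [Finset.sum_insert hi, add_comm (rankOne ℂ (u i) (v i)), ← add_assoc]
    exact hW.add_rankOne _ _

/-- Finite rank operators have a second quantization, itself of finite rank. -/
theorem HasFiniteRank.exists_isSecondQuantization {B : H →L[ℂ] H} (hB : HasFiniteRank B) :
    ∃ V, IsSecondQuantization B V ∧ HasFiniteRank V := by
  obtain ⟨n, u, v, rfl⟩ := hB
  simpa using exists_isSecondQuantization_add_sum isSecondQuantization_zero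
    (hasFiniteRank_rankOne vacuum vacuum) Finset.univ u v

variable [CompleteSpace H]

theorem contract_map (B : H →L[ℂ] H) (g : H) (x : ExteriorAlgebra ℂ H) :
    contract g (ExteriorAlgebra.map (B : H →ₗ[ℂ] H) x) =
      ExteriorAlgebra.map (B : H →ₗ[ℂ] H) (contract (B.adjoint g) x) := by
  induction x using exterior_induction with
  | h0 c => rw [contract_algebraMap, map_algebraMap, contract_algebraMap, map_zero]
  | hadd x y hx hy => simp only [map_add, hx, hy]
  | hmul f x hx =>
    rw [map_ι_mul, contract_ι_mul, contract_ι_mul, map_sub, map_smul, map_ι_mul, hx,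
      ContinuousLinearMap.adjoint_inner_left]

theorem fockForm_map (B : H →L[ℂ] H) (x y : ExteriorAlgebra ℂ H) :
    fockForm (ExteriorAlgebra.map (B : H →ₗ[ℂ] H) x) y =
      fockForm x (ExteriorAlgebra.map (B.adjoint : H →ₗ[ℂ] H) y) := by
  induction y using exterior_induction generalizing x with
  | h0 c => rw [map_algebraMap, fockForm_algebraMap, fockForm_algebraMap, algebraMapInv_map]
  | hadd y z hy hz => simp only [map_add, fockForm_add_right, hy, hz]
  | hmul g y hy => rw [map_ι_mul, fockForm_ι_mul_right, fockForm_ι_mul_right, contract_map, hy]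

namespace IsSecondQuantization

variable {B : H →L[ℂ] H} {V : Fock H →L[ℂ] Fock H}

theorem adjoint (h : IsSecondQuantization B V) : IsSecondQuantization B.adjoint V.adjoint :=
  fun x => fock_ext fun y => by
    rw [ContinuousLinearMap.adjoint_inner_right, h, inner_toFock, inner_toFock, fockForm_map]

theorem annihilate_mul (h : IsSecondQuantization B V) (g : H) :
    annihilate g * V = V * annihilate (B.adjoint g) := by
  have := congrArg ContinuousLinearMap.adjoint (h.adjoint.mul_create g)
  rw [ContinuousLinearMap.mul_def, ContinuousLinearMap.mul_def, ContinuousLinearMap.adjoint_comp,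
    ContinuousLinearMap.adjoint_comp, ContinuousLinearMap.adjoint_adjoint] at this
  exact this

end IsSecondQuantization

/-- The fermion parity operator, second quantization of `-1`. -/
theorem exists_isSecondQuantization_neg_one :
    ∃ U : Fock H →L[ℂ] Fock H, IsSecondQuantization (-1) U := by
  have hadj : (-1 : H →L[ℂ] H).adjoint = -1 := by
    rw [map_neg, ContinuousLinearMap.one_def, ContinuousLinearMap.adjoint_id]
  have hsq : ∀ x : ExteriorAlgebra ℂ H, ExteriorAlgebra.map ((-1 : H →L[ℂ] H) : H →ₗ[ℂ] H)
      (ExteriorAlgebra.map ((-1 : H →L[ℂ] H) : H →ₗ[ℂ] H) x) = x := fun x => by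
    have e : ((-1 : H →L[ℂ] H) : H →ₗ[ℂ] H) ∘ₗ ((-1 : H →L[ℂ] H) : H →ₗ[ℂ] H) = LinearMap.id := by
      ext f; simp
    have := DFunLike.congr_fun (ExteriorAlgebra.map_comp_map ((-1 : H →L[ℂ] H) : H →ₗ[ℂ] H)
      ((-1 : H →L[ℂ] H) : H →ₗ[ℂ] H)) x
    rw [e, ExteriorAlgebra.map_id] at this
    exact this
  have hform : ∀ x : ExteriorAlgebra ℂ H,
      fockForm (ExteriorAlgebra.map ((-1 : H →L[ℂ] H) : H →ₗ[ℂ] H) x)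
        (ExteriorAlgebra.map ((-1 : H →L[ℂ] H) : H →ₗ[ℂ] H) x) = fockForm x x := fun x => by
    rw [fockForm_map, hadj, hsq]
  let L : AlgFock H →L[ℂ] AlgFock H := LinearMap.mkContinuous
    ((ExteriorAlgebra.map ((-1 : H →L[ℂ] H) : H →ₗ[ℂ] H)).toLinearMap :
      ExteriorAlgebra ℂ H →ₗ[ℂ] ExteriorAlgebra ℂ H) 1 (fun x => by
      refine le_of_sq_le_sq ?_ (by positivity)
      rw [one_mul, algFock_norm_sq, algFock_norm_sq]
      exact (congrArg Complex.re (hform x)).le)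
  exact ⟨L.completion, fun x => ContinuousLinearMap.completion_apply_coe L (x : AlgFock H)⟩

end SecondQuantization

/-! ### Products of creation operators -/

section Products

variable {H : Type u} [NormedAddCommGroup H] [InnerProductSpace ℂ H]

/-- `a†(f₁) ⋯ a†(f_q)`. -/
noncomputable def createProd {q : ℕ} (f : Fin q → H) : Fock H →L[ℂ] Fock H :=
  (List.ofFn fun i => create (f i)).prod

theorem createProd_zero (f : Fin 0 → H) : createProd f = 1 := by simp [createProd]

theorem createProd_succ {q : ℕ} (f : Fin (q + 1) → H) :
    createProd f = create (f 0) * createProd fun i => f i.succ := by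
  simp [createProd, List.ofFn_succ]

theorem createProd_one (f : Fin 1 → H) : createProd f = create (f 0) := by
  rw [createProd_succ, createProd_zero, mul_one]

theorem createProd_snoc {q : ℕ} (f : Fin q → H) (e : H) :
    createProd (Fin.snoc f e : Fin (q + 1) → H) = createProd f * create e := by
  rw [createProd, List.ofFn_succ']
  simp [createProd]

theorem adjoint_createProd {q : ℕ} (g : Fin q → H) :
    (createProd g).adjoint = (List.ofFn fun i => annihilate (g i)).reverse.prod := by
  induction q with
  | zero => simp [createProd_zero, ContinuousLinearMap.one_def, ContinuousLinearMap.adjoint_id]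
  | succ q ih =>
    rw [createProd_succ, ContinuousLinearMap.mul_def, ContinuousLinearMap.adjoint_comp, ih,
      List.ofFn_succ, List.reverse_cons, List.prod_append, List.prod_singleton]
    rfl

theorem densityMatrix_eq (Γ : Fock H →L[ℂ] Fock H) {p q : ℕ} (g : Fin p → H) (f : Fin q → H) :
    densityMatrix Γ g f = trace (Γ * createProd f * (createProd g).adjoint) := by
  rw [densityMatrix, adjoint_createProd]
  rfl

theorem createProd_vacuum {q : ℕ} (f : Fin q → H) : createProd f vacuum = wedge f := by
  induction q with
  | zero => simp [createProd_zero, wedge, vacuum]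
  | succ q ih =>
    rw [createProd_succ, ContinuousLinearMap.mul_def, ContinuousLinearMap.comp_apply, ih, wedge,
      create_toFock, wedge, ExteriorAlgebra.ιMulti_succ_apply]
    rfl

theorem create_mul_createProd {q : ℕ} (e : H) (f : Fin q → H) :
    create e * createProd f = (-1 : ℂ) ^ q • (createProd f * create e) := by
  induction q with
  | zero => simp [createProd_zero]
  | succ q ih =>
    rw [createProd_succ, ← mul_assoc, create_mul_create, neg_mul, mul_assoc, ih, mul_smul_comm,
      mul_assoc, pow_succ, mul_neg_one, neg_smul]

theorem adjoint_createProd_mul_annihilate {q : ℕ} (e : H) (f : Fin q → H) :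
    (createProd f).adjoint * annihilate e =
      (-1 : ℂ) ^ q • (annihilate e * (createProd f).adjoint) := by
  have h := congrArg ContinuousLinearMap.adjoint (create_mul_createProd e f)
  rw [map_smulₛₗ, ContinuousLinearMap.mul_def, ContinuousLinearMap.mul_def,
    ContinuousLinearMap.adjoint_comp, ContinuousLinearMap.adjoint_comp] at h
  have hc : conj ((-1 : ℂ) ^ q) = (-1) ^ q := by simp
  rw [hc] at h
  exact h

theorem IsSecondQuantization.mul_createProd {B : H →L[ℂ] H} {V : Fock H →L[ℂ] Fock H}
    (h : IsSecondQuantization B V) {q : ℕ} (f : Fin q → H) :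
    V * createProd f = (createProd fun i => B (f i)) * V := by
  induction q with
  | zero => simp [createProd_zero]
  | succ q ih =>
    rw [createProd_succ, createProd_succ, ← mul_assoc, h.mul_create, mul_assoc, ih, mul_assoc]

theorem IsSecondQuantization.adjoint_createProd_mul [CompleteSpace H] {B : H →L[ℂ] H}
    {V : Fock H →L[ℂ] Fock H} (h : IsSecondQuantization B V) {q : ℕ} (f : Fin q → H) :
    (createProd f).adjoint * V = V * (createProd fun i => B.adjoint (f i)).adjoint := by
  have := congrArg ContinuousLinearMap.adjoint (h.adjoint.mul_createProd f)
  rwa [ContinuousLinearMap.mul_def, ContinuousLinearMap.mul_def, ContinuousLinearMap.adjoint_comp,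
    ContinuousLinearMap.adjoint_comp, ContinuousLinearMap.adjoint_adjoint] at this

theorem continuous_createProd {q : ℕ} :
    Continuous (createProd : (Fin q → H) → Fock H →L[ℂ] Fock H) := by
  induction q with
  | zero =>
    have : (createProd : (Fin 0 → H) → Fock H →L[ℂ] Fock H) = fun _ => 1 :=
      funext createProd_zero
    rw [this]
    exact continuous_const
  | succ q ih =>
    have : (createProd : (Fin (q + 1) → H) → Fock H →L[ℂ] Fock H) =
        fun f => create (f 0) * createProd fun i => f i.succ := funext createProd_succ
    rw [this]
    exact (continuous_create.comp (continuous_apply 0)).mul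
      (ih.comp (continuous_pi fun i => continuous_apply i.succ))

end Products

/-! ### Sectors of fixed particle number -/

section Sectors

variable {H : Type u} [NormedAddCommGroup H] [InnerProductSpace ℂ H]

theorem wedge_mem_sector {n : ℕ} (f : Fin n → H) : wedge f ∈ sector H n :=
  Submodule.le_topologicalClosure _ (Submodule.subset_span ⟨f, rfl⟩)

theorem sector_le {n : ℕ} {K : Submodule ℂ (Fock H)} (hK : IsClosed (K : Set (Fock H)))
    (h : ∀ f : Fin n → H, wedge f ∈ K) : sector H n ≤ K := by
  refine Submodule.topologicalClosure_minimal _ (Submodule.span_le.2 ?_) hK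
  rintro _ ⟨f, rfl⟩
  exact h f

theorem isClosed_sector (n : ℕ) : IsClosed (sector H n : Set (Fock H)) :=
  Submodule.isClosed_topologicalClosure _

theorem map_mem_sector {n m : ℕ} {T : Fock H →L[ℂ] Fock H}
    (h : ∀ f : Fin n → H, T (wedge f) ∈ sector H m) {ψ : Fock H} (hψ : ψ ∈ sector H n) :
    T ψ ∈ sector H m :=
  sector_le (K := (sector H m).comap (T : Fock H →ₗ[ℂ] Fock H))
    ((isClosed_sector m).preimage T.continuous) h hψ

theorem eq_on_sector {n : ℕ} {S T : Fock H →L[ℂ] Fock H}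
    (h : ∀ f : Fin n → H, S (wedge f) = T (wedge f)) {ψ : Fock H} (hψ : ψ ∈ sector H n) :
    S ψ = T ψ :=
  sector_le (K := LinearMap.eqLocus (S : Fock H →ₗ[ℂ] Fock H) (T : Fock H →ₗ[ℂ] Fock H))
    (isClosed_eq S.continuous T.continuous) h hψ

theorem IsSecondQuantization.mem_sector {B : H →L[ℂ] H} {V : Fock H →L[ℂ] Fock H}
    (h : IsSecondQuantization B V) {n : ℕ} {ψ : Fock H} (hψ : ψ ∈ sector H n) :
    V ψ ∈ sector H n :=
  map_mem_sector (fun f => by rw [h.apply_wedge]; exact wedge_mem_sector _) hψ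

theorem annihilate_mem_sector (g : H) {n : ℕ} {ψ : Fock H} (hψ : ψ ∈ sector H (n + 1)) :
    annihilate g ψ ∈ sector H n := by
  refine map_mem_sector (fun f => ?_) hψ
  rw [wedge, annihilate_toFock, contract_ιMulti, toFock_sum]
  refine Submodule.sum_mem _ fun j _ => ?_
  rw [toFock_smul]
  exact Submodule.smul_mem _ _ (wedge_mem_sector _)

theorem annihilate_sector_zero (g : H) {ψ : Fock H} (hψ : ψ ∈ sector H 0) :
    annihilate g ψ = 0 := by
  refine eq_on_sector (S := annihilate g) (T := 0) (fun f => ?_) hψ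
  have h := contract_algebraMap g (1 : ℂ)
  rw [map_one] at h
  rw [wedge, annihilate_toFock, ExteriorAlgebra.ιMulti_zero_apply, h, toFock_zero,
    zero_apply]

theorem inner_eq_zero_of_mem_sector {m n : ℕ} (hmn : m ≠ n) {φ ψ : Fock H} (hφ : φ ∈ sector H m)
    (hψ : ψ ∈ sector H n) : ⟪φ, ψ⟫_ℂ = 0 := by
  have h1 : ∀ (g : Fin m → H) {ψ}, ψ ∈ sector H n → ⟪wedge g, ψ⟫_ℂ = 0 := fun g ψ hψ =>
    sector_le (K := ((innerSL ℂ (wedge g)).ker))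
      (ContinuousLinearMap.isClosed_ker _) (fun f => inner_wedge_of_ne hmn g f) hψ
  have h2 : ⟪ψ, φ⟫_ℂ = 0 := sector_le (K := ((innerSL ℂ ψ).ker))
    (ContinuousLinearMap.isClosed_ker _) (fun g => inner_eq_zero_symm.1 (h1 g hψ)) hφ
  exact inner_eq_zero_symm.1 h2

/-- The second quantization of `-1` is the parity of the particle number. -/
theorem parity_apply {U : Fock H →L[ℂ] Fock H} (hU : IsSecondQuantization (-1 : H →L[ℂ] H) U)
    {n : ℕ} {ψ : Fock H} (hψ : ψ ∈ sector H n) : U ψ = (-1 : ℂ) ^ n • ψ := by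
  refine eq_on_sector (S := U) (T := (-1 : ℂ) ^ n • (1 : Fock H →L[ℂ] Fock H)) (fun f => ?_) hψ
  have h : (fun i => (-1 : H →L[ℂ] H) (f i)) = fun i => (-1 : ℂ) • f i := by ext i; simp
  have h' := (ExteriorAlgebra.ιMulti ℂ n).toMultilinearMap.map_smul_univ (fun _ => (-1 : ℂ)) f
  simp only [Finset.prod_const, Finset.card_univ, Fintype.card_fin] at h'
  rw [hU.apply_wedge, h, wedge]
  exact (congrArg toFock h').trans (toFock_smul _ _)

end Sectors

/-! ### States with particles in a subspace -/

section Support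

variable {H : Type u} [NormedAddCommGroup H] [InnerProductSpace ℂ H]

/-- The vectors in the range of `T` only involve particles in `E`: they are annihilated by all
`a(g)` with `g` orthogonal to `E`. -/
def SupportedIn (E : Submodule ℂ H) (T : Fock H →L[ℂ] Fock H) : Prop :=
  ∀ g ∈ Eᗮ, annihilate g * T = 0

theorem SupportedIn.mul_right {E : Submodule ℂ H} {T : Fock H →L[ℂ] Fock H}
    (h : SupportedIn E T) (C : Fock H →L[ℂ] Fock H) : SupportedIn E (T * C) := fun g hg => by
  rw [← mul_assoc, h g hg, zero_mul]

theorem SupportedIn.mono {E F : Submodule ℂ H} {T : Fock H →L[ℂ] Fock H}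
    (h : SupportedIn E T) (hEF : E ≤ F) : SupportedIn F T := fun g hg =>
  h g (Submodule.orthogonal_le hEF hg)

/-- Annihilating a particle in the state `e` leaves no particle in that state. -/
theorem SupportedIn.annihilate_mul {E : Submodule ℂ H} {T : Fock H →L[ℂ] Fock H}
    (h : SupportedIn E T) {e : H} (heE : e ∈ E) (he : ‖e‖ = 1) :
    SupportedIn ((ℂ ∙ e)ᗮ ⊓ E) (annihilate e * T) := fun g hg => by
  have hee : ⟪e, e⟫_ℂ = 1 := inner_self_eq_one_of_norm_eq_one he
  have hg1 : g - ⟪e, g⟫_ℂ • e ∈ Eᗮ := fun x hx => by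
    have h1 := hg (x - ⟪e, x⟫_ℂ • e) ⟨Submodule.mem_orthogonal_singleton_iff_inner_right.2
      (by rw [inner_sub_right, inner_smul_right, hee, mul_one, sub_self]),
      E.sub_mem hx (E.smul_mem _ heE)⟩
    rw [inner_sub_left, inner_smul_left, inner_conj_symm] at h1
    rw [inner_sub_right, inner_smul_right, mul_comm]
    exact h1
  rw [← sub_add_cancel g (⟪e, g⟫_ℂ • e), annihilate_add, annihilate_smul, add_mul, smul_mul_assoc,
    ← mul_assoc (annihilate e), annihilate_mul_self, zero_mul, smul_zero, add_zero, ← mul_assoc,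
    annihilate_mul_annihilate, neg_mul, mul_assoc, h _ hg1, mul_zero, neg_zero]

theorem exists_isSecondQuantization_starProjection (E : Submodule ℂ H) [FiniteDimensional ℂ E] :
    ∃ V, IsSecondQuantization E.starProjection V ∧ HasFiniteRank V := by
  refine HasFiniteRank.exists_isSecondQuantization ?_
  rw [(stdOrthonormalBasis ℂ E).starProjection_eq_sum_rankOne]
  exact ⟨_, _, _, rfl⟩

variable [CompleteSpace H]

theorem SupportedIn.secondQuantization {E : Submodule ℂ H} {T : Fock H →L[ℂ] Fock H}
    (h : SupportedIn E T) {B : H →L[ℂ] H} {V : Fock H →L[ℂ] Fock H}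
    (hV : IsSecondQuantization B V) :
    SupportedIn (E.map (B : H →ₗ[ℂ] H)) (V * T) := fun g hg => by
  rw [← mul_assoc, hV.annihilate_mul, mul_assoc, h, mul_zero]
  rw [Submodule.mem_orthogonal] at hg ⊢
  intro u hu
  rw [ContinuousLinearMap.adjoint_inner_right]
  exact hg _ (Submodule.mem_map_of_mem hu)

/-- A vector annihilated by all `a(g)` with `g` orthogonal to `E` is fixed by the second quantized
projection on `E`. -/
theorem secondQuantization_starProjection_apply {E : Submodule ℂ H} [E.HasOrthogonalProjection]
    {V : Fock H →L[ℂ] Fock H} (hV : IsSecondQuantization E.starProjection V) {ψ : Fock H}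
    (hψ : ∀ g ∈ Eᗮ, annihilate g ψ = 0) : V ψ = ψ := by
  have hadj : E.starProjection.adjoint = E.starProjection := isSelfAdjoint_starProjection E
  refine fock_ext fun x => ?_
  induction x using exterior_induction generalizing ψ with
  | h0 c =>
    have h1 := hV.adjoint.apply_vacuum
    rw [Algebra.algebraMap_eq_smul_one, toFock_smul, inner_smul_left, inner_smul_left]
    change _ * ⟪vacuum, _⟫_ℂ = _ * ⟪vacuum, _⟫_ℂ
    rw [← ContinuousLinearMap.adjoint_inner_left, h1]
  | hadd x y hx hy => rw [toFock_add, inner_add_left, inner_add_left, hx hψ, hy hψ]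
  | hmul f x hx =>
    have hf : annihilate f ψ = annihilate (E.starProjection f) ψ := by
      have h1 := hψ _ (E.sub_starProjection_mem_orthogonal f)
      rw [← sub_add_cancel f (E.starProjection f), annihilate_add, add_apply, h1, zero_add]
      simp
    have h2 : annihilate f (V ψ) = V (annihilate f ψ) := by
      have := DFunLike.congr_fun (hV.annihilate_mul f) ψ
      rw [hadj] at this
      rw [hf]
      exact this
    rw [← create_toFock, ← ContinuousLinearMap.adjoint_inner_right,
      ← ContinuousLinearMap.adjoint_inner_right]
    change ⟪_, annihilate f _⟫_ℂ = ⟪_, annihilate f _⟫_ℂ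
    rw [h2]
    refine hx fun g hg => ?_
    have := DFunLike.congr_fun (annihilate_mul_annihilate g f) ψ
    simp only [ContinuousLinearMap.mul_def, ContinuousLinearMap.comp_apply, neg_apply, hψ g hg,
      map_zero, neg_zero] at this
    exact this

theorem SupportedIn.secondQuantization_mul {E : Submodule ℂ H} [E.HasOrthogonalProjection]
    {T V : Fock H →L[ℂ] Fock H} (h : SupportedIn E T)
    (hV : IsSecondQuantization E.starProjection V) : V * T = T := by
  ext ψ : 1
  exact secondQuantization_starProjection_apply hV fun g hg => DFunLike.congr_fun (h g hg) ψ

theorem SupportedIn.hasFiniteRank {E : Submodule ℂ H} [FiniteDimensional ℂ E]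
    {T : Fock H →L[ℂ] Fock H} (h : SupportedIn E T) : HasFiniteRank T := by
  obtain ⟨V, hV, hf⟩ := exists_isSecondQuantization_starProjection E
  rw [← h.secondQuantization_mul hV]
  exact hf.mul_right T

end Support

/-! ### Density matrices -/

section DensityMatrices

variable {H : Type u} [NormedAddCommGroup H] [InnerProductSpace ℂ H]

theorem trace_eq_densityMatrix (T : Fock H →L[ℂ] Fock H) :
    trace T = densityMatrix T (Fin.elim0 : Fin 0 → H) (Fin.elim0 : Fin 0 → H) := by
  rw [densityMatrix_eq, createProd_zero, ContinuousLinearMap.one_def,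
    ContinuousLinearMap.adjoint_id]
  rfl

/-- A state whose one-body density matrix vanishes off `E` only has particles in `E`. -/
theorem IsState.supportedIn {T : Fock H →L[ℂ] Fock H} (hT : IsState T) {E : Submodule ℂ H}
    (h : ∀ g ∈ Eᗮ, densityMatrix T (fun _ : Fin 1 => g) (fun _ : Fin 1 => g) = 0) :
    SupportedIn E T := fun g hg => by
  refine hT.comp_eq_zero ?_
  rw [← h g hg, densityMatrix_eq, createProd_one, adjoint_annihilate, mul_assoc]
  rfl

theorem eq_zero_of_inner_wedge {T : Fock H →L[ℂ] Fock H}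
    (h : ∀ (p q : ℕ) (g : Fin p → H) (f : Fin q → H), ⟪wedge g, T (wedge f)⟫_ℂ = 0) : T = 0 := by
  have key : ∀ p : ExteriorAlgebra ℂ H → Prop, p 0 → (∀ x y, p x → p y → p (x + y)) →
      (∀ (c : ℂ) x, p x → p (c • x)) → (∀ n (f : Fin n → H), p (ExteriorAlgebra.ιMulti ℂ n f)) →
      ∀ x, p x := by
    intro p h0 hadd hsmul hw x
    have hx : x ∈ Submodule.span ℂ (Set.range fun x : Σ n, (Fin n → H) =>
        ExteriorAlgebra.ιMulti ℂ x.1 x.2) := by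
      rw [ExteriorAlgebra.ιMulti_span]; trivial
    induction hx using Submodule.span_induction with
    | mem x hx => obtain ⟨⟨n, f⟩, rfl⟩ := hx; exact hw n f
    | zero => exact h0
    | add x y _ _ hx hy => exact hadd x y hx hy
    | smul c x _ hx => exact hsmul c x hx
  refine fock_clm_ext fun x => fock_ext fun y => ?_
  rw [zero_apply, inner_zero_right]
  refine key (fun x => ⟪toFock y, T (toFock x)⟫_ℂ = 0) (by simp [toFock_zero])
    (fun x z hx hz => by rw [toFock_add, map_add, inner_add_right, hx, hz, add_zero])
    (fun c x hx => by rw [toFock_smul, map_smul, inner_smul_right, hx, mul_zero])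
    (fun n f => ?_) x
  refine key (fun y => ⟪toFock y, T (wedge f)⟫_ℂ = 0) (by simp [toFock_zero])
    (fun x z hx hz => by rw [toFock_add, inner_add_left, hx, hz, add_zero])
    (fun c x hx => by rw [toFock_smul, inner_smul_left, hx, mul_zero])
    (fun m g => h m n g f) y

variable [CompleteSpace H]

theorem SupportedIn.mul_secondQuantization {E : Submodule ℂ H} [E.HasOrthogonalProjection]
    {T V : Fock H →L[ℂ] Fock H} (h : SupportedIn E T) (hT : T.adjoint = T)
    (hV : IsSecondQuantization E.starProjection V) : T * V = T := by
  have hP : E.starProjection.adjoint = E.starProjection := isSelfAdjoint_starProjection E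
  have hVa : V.adjoint = V := (hP ▸ hV.adjoint : IsSecondQuantization E.starProjection _).unique hV
  have := congrArg ContinuousLinearMap.adjoint (h.secondQuantization_mul hV)
  rwa [ContinuousLinearMap.mul_def, ContinuousLinearMap.adjoint_comp, hT, hVa] at this

/-- Inserting the second quantized projection `V` on both sides of `T` by cyclicity and moving it
inwards projects the one-body vectors on `E`. -/
theorem trace_createProd_eq {E : Submodule ℂ H} [FiniteDimensional ℂ E]
    {T V C : Fock H →L[ℂ] Fock H} (h : SupportedIn E T) (hT : T.adjoint = T)
    (hV : IsSecondQuantization E.starProjection V) (hC : V * C * V = V)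
    {p q : ℕ} (g : Fin p → H) (f : Fin q → H) :
    trace (T * createProd f * C * (createProd g).adjoint) =
      trace (T * (createProd fun i => E.starProjection (f i)) * V *
        (createProd fun i => E.starProjection (g i)).adjoint) := by
  have hP : E.starProjection.adjoint = E.starProjection := isSelfAdjoint_starProjection E
  have e1 := hV.mul_createProd f
  have e2 := hV.adjoint_createProd_mul g
  rw [hP] at e2
  calc _ = trace (V * (T * V * createProd f * C * (createProd g).adjoint)) := by
        rw [h.mul_secondQuantization hT hV]
        simp only [← mul_assoc, h.secondQuantization_mul hV]
    _ = trace (T * V * createProd f * C * (createProd g).adjoint * V) :=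
        (trace_mul_comm (by simpa only [mul_assoc] using h.hasFiniteRank.mul_right _) _).symm
    _ = trace (T * (V * createProd f) * C * ((createProd g).adjoint * V)) := by
        simp only [mul_assoc]
    _ = _ := by
        rw [e1, e2]
        congr 1
        calc _ = T * (createProd fun i => E.starProjection (f i)) * (V * C * V) *
              (createProd fun i => E.starProjection (g i)).adjoint := by simp only [mul_assoc]
          _ = _ := by rw [hC]

/-- The density matrices of a state with particles in `E` only depend on the components in `E` of
the one-body vectors. The second quantized projection in the middle is harmless. -/
theorem densityMatrix_eq_projection {E : Submodule ℂ H} [FiniteDimensional ℂ E]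
    {T V : Fock H →L[ℂ] Fock H} (h : SupportedIn E T) (hT : T.adjoint = T)
    (hV : IsSecondQuantization E.starProjection V) {p q : ℕ} (g : Fin p → H) (f : Fin q → H) :
    densityMatrix T g f = trace (T * (createProd fun i => E.starProjection (f i)) * V *
        (createProd fun i => E.starProjection (g i)).adjoint) := by
  have hVV : V * V = V := by
    have := hV.mul hV
    rw [E.isIdempotentElem_starProjection.eq] at this
    exact this.unique hV
  rw [densityMatrix_eq, ← trace_createProd_eq h hT hV (C := 1) (by rw [mul_one, hVV]), mul_one]

/-- As `densityMatrix_eq_projection`, without projecting the one-body vectors. -/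
theorem densityMatrix_eq_middle {E : Submodule ℂ H} [FiniteDimensional ℂ E]
    {T V : Fock H →L[ℂ] Fock H} (h : SupportedIn E T) (hT : T.adjoint = T)
    (hV : IsSecondQuantization E.starProjection V) {p q : ℕ} (g : Fin p → H) (f : Fin q → H) :
    densityMatrix T g f = trace (T * createProd f * V * (createProd g).adjoint) := by
  have hVV : V * V = V := by
    have := hV.mul hV
    rw [E.isIdempotentElem_starProjection.eq] at this
    exact this.unique hV
  rw [densityMatrix_eq_projection h hT hV, ← trace_createProd_eq h hT hV (C := V) (by rw [hVV, hVV])]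

theorem isLocalization_starProjection {E : Submodule ℂ H} [FiniteDimensional ℂ E]
    {T : Fock H →L[ℂ] Fock H} (h : SupportedIn E T) (hT : T.adjoint = T) :
    IsLocalization E.starProjection T T := by
  have hP : E.starProjection.adjoint = E.starProjection := isSelfAdjoint_starProjection E
  obtain ⟨V, hV, -⟩ := exists_isSecondQuantization_starProjection E
  have hPP : ∀ x, E.starProjection (E.starProjection x) = E.starProjection x := fun x =>
    DFunLike.congr_fun E.isIdempotentElem_starProjection.eq x
  intro p q g f
  rw [densityMatrix_eq_projection h hT hV, densityMatrix_eq_projection h hT hV]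
  simp only [hP, hPP]

/-- An operator on the Fock space of a finite-dimensional space is determined by its density
matrices: normal ordering of the vacuum projection `∏ (1 - a†(eᵢ) a(eᵢ))` expresses
`⟪wedge g, T wedge f⟫ = tr (T a†(f₁) ⋯ |Ω⟩⟨Ω| ⋯ a(g₁))` through them. -/
theorem eq_zero_of_densityMatrix {E : Submodule ℂ H} [FiniteDimensional ℂ E]
    {T : Fock H →L[ℂ] Fock H} (h : SupportedIn E T) (hT : T.adjoint = T)
    (hd : ∀ (p q : ℕ) (g : Fin p → H) (f : Fin q → H), densityMatrix T g f = 0) : T = 0 := by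
  classical
  obtain ⟨V, hV, -⟩ := exists_isSecondQuantization_starProjection E
  have hfin := h.hasFiniteRank
  set e := stdOrthonormalBasis ℂ E
  have key : ∀ s : Finset (Fin (Module.finrank ℂ E)), ∃ M,
      IsSecondQuantization (E.starProjection - ∑ i ∈ s, rankOne ℂ (e i : H) (e i : H)) M ∧
      ∀ (p q : ℕ) (g : Fin p → H) (f : Fin q → H),
        trace (T * createProd f * M * (createProd g).adjoint) = 0 := by
    intro s
    induction s using Finset.induction_on with
    | empty =>
      exact ⟨V, by simpa using hV, fun p q g f => by
        rw [← densityMatrix_eq_middle h hT hV, hd]⟩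
    | insert i s hi ih =>
      obtain ⟨M, hM, h0⟩ := ih
      refine ⟨M - create (e i : H) * M * annihilate (e i : H), ?_, fun p q g f => ?_⟩
      · have := hM.add_rankOne (-(e i : H)) (e i : H)
        have e1 : create (-(e i : H)) = -create (e i : H) := by
          simpa using create_smul (-1) (e i : H)
        rw [e1, neg_mul, neg_mul, ← sub_eq_add_neg] at this
        rw [Finset.sum_insert hi]
        convert this using 1
        rw [map_neg, neg_apply]
        abel
      · have h1 := h0 _ _ (Fin.snoc g (e i : H) : Fin (p + 1) → H)
          (Fin.snoc f (e i : H) : Fin (q + 1) → H)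
        rw [createProd_snoc, createProd_snoc, ContinuousLinearMap.mul_def (createProd g),
          ContinuousLinearMap.adjoint_comp] at h1
        have e2 : T * createProd f * (M - create (e i : H) * M * annihilate (e i : H)) *
            (createProd g).adjoint = T * createProd f * M * (createProd g).adjoint -
            T * (createProd f * create (e i : H)) * M *
              ((create (e i : H)).adjoint * (createProd g).adjoint) := by
          simp only [mul_sub, sub_mul, mul_assoc]
          rfl
        rw [e2, trace_sub (by simpa only [mul_assoc] using hfin.mul_right _)
          (by simpa only [mul_assoc] using hfin.mul_right _), h0, sub_eq_zero]
        exact h1.symm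
  obtain ⟨M, hM, h0⟩ := key Finset.univ
  rw [e.starProjection_eq_sum_rankOne, sub_self] at hM
  rw [hM.unique isSecondQuantization_zero] at h0
  refine eq_zero_of_inner_wedge fun p q g f => ?_
  have e3 : T * createProd f * rankOne ℂ vacuum vacuum * (createProd g).adjoint =
      rankOne ℂ (T (wedge f)) (wedge g) := by
    rw [← createProd_vacuum, ← createProd_vacuum]
    simp only [ContinuousLinearMap.mul_def, comp_rankOne, rankOne_comp,
      ContinuousLinearMap.adjoint_adjoint, ContinuousLinearMap.comp_apply]
  rw [← trace_rankOne, ← e3, h0]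

end DensityMatrices

/-! ### Unnormalised states with few modes, and attenuation -/

section Pieces

variable {H : Type u} [NormedAddCommGroup H] [InnerProductSpace ℂ H]

/-- An unnormalised state of `k` particles living in a one-body space `E` of dimension at most
`r - N + k`, a bound written without truncated subtraction. -/
structure IsPiece (N r k : ℕ) (E : Submodule ℂ H) (T : Fock H →L[ℂ] Fock H) : Prop where
  isPositive : T.IsPositive
  mem_sector : ∀ ψ, T ψ ∈ sector H k
  supportedIn : SupportedIn E T
  finiteDimensional : FiniteDimensional ℂ E
  finrank_add_le : Module.finrank ℂ E + N ≤ r + k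
  le : k ≤ N

/-- The finite sums of unnormalised states, of various particle numbers, whose one-body spaces all
contain `s`. The vectors of `s` stand for the modes still to be attenuated. -/
noncomputable def pieceSums (N r : ℕ) (s : Set H) : AddSubmonoid (Fock H →L[ℂ] Fock H) :=
  AddSubmonoid.closure {T | ∃ k E, IsPiece N r k E T ∧ s ⊆ E}

variable {N r k : ℕ} {E : Submodule ℂ H} {T : Fock H →L[ℂ] Fock H}

theorem IsPiece.hasFiniteRank [CompleteSpace H] (h : IsPiece N r k E T) : HasFiniteRank T :=
  have := h.finiteDimensional
  h.supportedIn.hasFiniteRank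

theorem pieceSums_induction {s : Set H} {p : (Fock H →L[ℂ] Fock H) → Prop}
    (mem : ∀ k E T, IsPiece N r k E T → s ⊆ E → p T) (zero : p 0)
    (add : ∀ S T, p S → p T → p (S + T)) (hT : T ∈ pieceSums N r s) : p T := by
  induction hT using AddSubmonoid.closure_induction with
  | mem T hT => obtain ⟨k, E, h, hs⟩ := hT; exact mem k E T h hs
  | zero => exact zero
  | add S T _ _ hS hT => exact add S T hS hT

theorem IsPiece.mem_pieceSums {s : Set H} (h : IsPiece N r k E T) (hs : s ⊆ E) :
    T ∈ pieceSums N r s :=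
  AddSubmonoid.subset_closure ⟨k, E, h, hs⟩

theorem pieceSums_mono {s t : Set H} (h : s ⊆ t) : pieceSums N r t ≤ pieceSums N r s :=
  AddSubmonoid.closure_mono fun _ ⟨k, E, hT, ht⟩ => ⟨k, E, hT, h.trans ht⟩

theorem finrank_orthogonal_singleton_inf [FiniteDimensional ℂ E] {e : H} (heE : e ∈ E)
    (he : ‖e‖ = 1) : Module.finrank ℂ ((ℂ ∙ e)ᗮ ⊓ E : Submodule ℂ H) + 1 = Module.finrank ℂ E := by
  have h1 := Submodule.finrank_add_inf_finrank_orthogonal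
    ((Submodule.span_singleton_le_iff_mem e E).2 heE : (ℂ ∙ e) ≤ E)
  have he0 : e ≠ 0 := by
    rintro rfl
    simp at he
  rw [finrank_span_singleton he0] at h1
  omega

/-- Annihilating a particle of `E` lowers the number of particles and the dimension of the
one-body space by one. -/
theorem IsPiece.conj_annihilate_mem {s : Set H} (h : IsPiece N r k E T) {e : H} (heE : e ∈ E)
    (he : ‖e‖ = 1) (hs : s ⊆ E) (hse : ∀ x ∈ s, ⟪e, x⟫_ℂ = 0) {μ : ℝ} (hμ : 0 ≤ μ) :
    (μ : ℂ) • (annihilate e * T * create e) ∈ pieceSums N r s := by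
  have := h.finiteDimensional
  cases k with
  | zero =>
    have h0 : annihilate e * T = 0 := by
      ext ψ : 1
      exact annihilate_sector_zero e (h.mem_sector ψ)
    rw [h0, zero_mul, smul_zero]
    exact zero_mem _
  | succ k =>
    refine IsPiece.mem_pieceSums (k := k) (E := (ℂ ∙ e)ᗮ ⊓ E) ⟨?_, fun ψ => ?_, ?_, ?_, ?_, ?_⟩ ?_
    · refine ContinuousLinearMap.IsPositive.smul_of_nonneg ?_ (by exact_mod_cast hμ)
      have := h.isPositive.conj_adjoint (annihilate e)
      rw [adjoint_annihilate] at this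
      exact this
    · exact Submodule.smul_mem _ _ (annihilate_mem_sector e (h.mem_sector _))
    · rw [← mul_smul_comm]
      exact (h.supportedIn.annihilate_mul heE he).mul_right _
    · infer_instance
    · have h1 := finrank_orthogonal_singleton_inf heE he
      have h2 := h.finrank_add_le
      omega
    · exact (Nat.le_succ k).trans h.le
    · exact fun x hx => ⟨Submodule.mem_orthogonal_singleton_iff_inner_right.2 (hse x hx), hs hx⟩

theorem isPositive_of_mem_pieceSums {s : Set H} (hT : T ∈ pieceSums N r s) : T.IsPositive :=
  pieceSums_induction (p := fun T => T.IsPositive) (fun _ _ _ h _ => h.isPositive)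
    ContinuousLinearMap.isPositive_zero (fun _ _ h h' => h.add h') hT

theorem createProd_neg {q : ℕ} (f : Fin q → H) :
    (createProd fun i => (-1 : H →L[ℂ] H) (f i)) = (-1 : ℂ) ^ q • createProd f := by
  induction q with
  | zero => simp [createProd_zero]
  | succ q ih =>
    have e1 : create ((-1 : H →L[ℂ] H) (f 0)) = (-1 : ℂ) • create (f 0) := by
      rw [← create_smul]; simp
    rw [createProd_succ, createProd_succ, ih, e1, mul_smul_comm, smul_mul_assoc, smul_smul, pow_succ]

/-- The effect on density matrices with `p + q` even of annihilating a particle: the operators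
`a(e)` and `a†(e)` can be moved next to each other. -/
theorem trace_conj_annihilate {X : Fock H →L[ℂ] Fock H} (hX : HasFiniteRank X)
    (M : Fock H →L[ℂ] Fock H) (e : H) {p q : ℕ} (hpq : Even (p + q)) (g : Fin p → H)
    (f : Fin q → H) :
    trace (annihilate e * X * create e * createProd f * M * (createProd g).adjoint) =
      trace (X * createProd f * (create e * M * annihilate e) * (createProd g).adjoint) := by
  have hsign : (-1 : ℂ) ^ p * (-1) ^ q = 1 := by
    rw [← pow_add, hpq.neg_one_pow]
  have hfin : HasFiniteRank (X * (create e * createProd f * M * (createProd g).adjoint)) :=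
    hX.mul_right _
  calc _ = trace (annihilate e * (X * (create e * createProd f * M * (createProd g).adjoint))) := by
        simp only [mul_assoc]
    _ = trace (X * (create e * createProd f) * M * ((createProd g).adjoint * annihilate e)) := by
        rw [← trace_mul_comm hfin]
        simp only [mul_assoc]
    _ = _ := by
        rw [create_mul_createProd, adjoint_createProd_mul_annihilate]
        simp only [mul_smul_comm, smul_mul_assoc, smul_smul, hsign, one_smul, mul_assoc]

variable [CompleteSpace H]

theorem IsPiece.conj_secondQuantization (h : IsPiece N r k E T) {B : H →L[ℂ] H}
    {V : Fock H →L[ℂ] Fock H} (hV : IsSecondQuantization B V) :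
    IsPiece N r k (E.map (B : H →ₗ[ℂ] H)) (V * T * V.adjoint) where
  isPositive := h.isPositive.conj_adjoint V
  mem_sector ψ := hV.mem_sector (h.mem_sector _)
  supportedIn := (h.supportedIn.secondQuantization hV).mul_right _
  finiteDimensional := have := h.finiteDimensional; inferInstance
  finrank_add_le := by
    have := h.finiteDimensional
    have h1 := Submodule.finrank_map_le (B : H →ₗ[ℂ] H) E
    have h2 := h.finrank_add_le
    omega
  le := h.le

theorem hasFiniteRank_of_mem_pieceSums {s : Set H} (hT : T ∈ pieceSums N r s) :
    HasFiniteRank T :=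
  pieceSums_induction (fun _ _ _ h _ => h.hasFiniteRank) HasFiniteRank.zero
    (fun _ _ => HasFiniteRank.add) hT

/-- Density matrices of an operator with a definite number of particles vanish unless they involve
an even number of creation and annihilation operators. -/
theorem IsPiece.densityMatrix_eq_zero (h : IsPiece N r k E T) {p q : ℕ} (hpq : ¬ Even (p + q))
    (g : Fin p → H) (f : Fin q → H) : densityMatrix T g f = 0 := by
  obtain ⟨U, hU⟩ := exists_isSecondQuantization_neg_one (H := H)
  have hadj : (-1 : H →L[ℂ] H).adjoint = -1 := by
    rw [map_neg, ContinuousLinearMap.one_def, ContinuousLinearMap.adjoint_id]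
  have hUa : U.adjoint = U := (hadj ▸ hU.adjoint : IsSecondQuantization (-1) _).unique hU
  have hT := h.isPositive.isSelfAdjoint.adjoint_eq
  have hUT : U * T = (-1 : ℂ) ^ k • T := by
    ext ψ : 1
    exact parity_apply hU (h.mem_sector ψ)
  have hTU : T * U = (-1 : ℂ) ^ k • T := by
    have := congrArg ContinuousLinearMap.adjoint hUT
    rw [ContinuousLinearMap.mul_def, ContinuousLinearMap.adjoint_comp, hT, hUa, map_smulₛₗ, hT] at this
    have hc : conj ((-1 : ℂ) ^ k) = (-1) ^ k := by simp
    rw [hc] at this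
    exact this
  have e1 := hU.mul_createProd f
  have e2 := hU.adjoint_createProd_mul g
  rw [hadj, createProd_neg, map_smulₛₗ] at e2
  rw [createProd_neg] at e1
  have hc : conj ((-1 : ℂ) ^ p) = (-1) ^ p := by simp
  rw [hc] at e2
  have hfin := h.hasFiniteRank
  have h1 : trace (U * (T * createProd f * (createProd g).adjoint)) =
      (-1 : ℂ) ^ k * trace (T * createProd f * (createProd g).adjoint) := by
    rw [← trace_smul (by simpa only [mul_assoc] using hfin.mul_right _)]
    simp only [← mul_assoc, hUT, smul_mul_assoc]
  have hg : (createProd g).adjoint * U = (-1 : ℂ) ^ p • (U * (createProd g).adjoint) := by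
    rw [e2, mul_smul_comm]
  have hf : createProd f * U = (-1 : ℂ) ^ q • (U * createProd f) := by
    rw [e1, smul_mul_assoc, smul_smul, ← pow_add, Even.neg_one_pow ⟨q, rfl⟩, one_smul]
  have h2 : trace (U * (T * createProd f * (createProd g).adjoint)) =
      (-1 : ℂ) ^ (p + q + k) * trace (T * createProd f * (createProd g).adjoint) := by
    rw [← trace_mul_comm (by simpa only [mul_assoc] using hfin.mul_right _),
      ← trace_smul (by simpa only [mul_assoc] using hfin.mul_right _)]
    congr 1
    calc _ = T * createProd f * ((createProd g).adjoint * U) := by simp only [mul_assoc]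
      _ = (-1 : ℂ) ^ p • (T * (createProd f * U) * (createProd g).adjoint) := by
          rw [hg]; simp only [mul_smul_comm, mul_assoc]
      _ = (-1 : ℂ) ^ p • (-1 : ℂ) ^ q • (T * U * createProd f * (createProd g).adjoint) := by
          rw [hf]; simp only [mul_smul_comm, smul_mul_assoc, mul_assoc]
      _ = _ := by
          rw [hTU]; simp only [smul_mul_assoc, smul_smul, pow_add, mul_assoc]
  rw [h2, pow_add, (Nat.not_even_iff_odd.1 hpq).neg_one_pow] at h1
  have hk : ((-1 : ℂ) ^ k) ≠ 0 := by simp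
  have h3 : (2 * (-1 : ℂ) ^ k) * trace (T * createProd f * (createProd g).adjoint) = 0 := by
    linear_combination -h1
  rw [densityMatrix_eq]
  exact (mul_eq_zero.1 h3).resolve_left (mul_ne_zero two_ne_zero hk)

/-- The attenuation of the modes `e i`, `i ∈ s`: by induction on `s`, a state `Γ` is changed into
a finite sum of states whose `(p, q)` moments are those of `Γ` with the second quantization of
`D + ∑ i ∈ s, μ i |e i⟩⟨e i|` in place of that of `D`. Each mode `e` contributes
`X ↦ X + μ a(e) X a†(e)`. -/
theorem IsPiece.exists_attenuation {ι : Type*} {Γ : Fock H →L[ℂ] Fock H}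
    (hΓ : IsPiece N r k E Γ) {e : ι → H} (he : Orthonormal ℂ e) (heE : ∀ i, e i ∈ E) {μ : ι → ℝ}
    (hμ : ∀ i, 0 ≤ μ i) (s : Finset ι) {D : H →L[ℂ] H} {M : Fock H →L[ℂ] Fock H}
    (hM : IsSecondQuantization D M) :
    ∃ X ∈ pieceSums N r (e '' (s : Set ι)ᶜ), ∃ M',
      IsSecondQuantization (D + ∑ i ∈ s, (μ i : ℂ) • rankOne ℂ (e i) (e i)) M' ∧
      ∀ (p q : ℕ) (g : Fin p → H) (f : Fin q → H), Even (p + q) →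
        trace (X * createProd f * M * (createProd g).adjoint) =
          trace (Γ * createProd f * M' * (createProd g).adjoint) := by
  classical
  induction s using Finset.induction_on generalizing D M with
  | empty =>
    refine ⟨Γ, hΓ.mem_pieceSums ?_, M, by simpa using hM, fun _ _ _ _ _ => rfl⟩
    rintro _ ⟨i, -, rfl⟩
    exact heE i
  | insert i s hi ih =>
    have hM1 : IsSecondQuantization (D + (μ i : ℂ) • rankOne ℂ (e i) (e i))
        (M + (μ i : ℂ) • (create (e i) * M * annihilate (e i))) := by
      have := hM.add_rankOne ((μ i : ℂ) • e i) (e i)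
      rwa [create_smul, smul_mul_assoc, smul_mul_assoc, map_smul, smul_apply] at this
    obtain ⟨X, hX, M', hM', h⟩ := ih hM1
    have hsub : e '' ((insert i s : Finset ι) : Set ι)ᶜ ⊆ e '' (s : Set ι)ᶜ :=
      Set.image_mono (Set.compl_subset_compl.2 (by simp))
    have hfin := hasFiniteRank_of_mem_pieceSums hX
    refine ⟨X + (μ i : ℂ) • (annihilate (e i) * X * create (e i)),
      add_mem (pieceSums_mono hsub hX) ?_, M', ?_, fun p q g f hpq => ?_⟩
    · refine pieceSums_induction (p := fun X => (μ i : ℂ) • (annihilate (e i) * X * create (e i)) ∈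
        pieceSums N r (e '' ((insert i s : Finset ι) : Set ι)ᶜ)) (fun k E T hT hs => ?_) ?_ ?_ hX
      · refine hT.conj_annihilate_mem (hs ⟨i, by simpa using hi, rfl⟩) (he.1 i) (hsub.trans hs) ?_
          (hμ i)
        rintro _ ⟨j, hj, rfl⟩
        refine he.2 ?_
        rintro rfl
        simp at hj
      · simp
      · intro S T hS hT
        rw [mul_add, add_mul, smul_add]
        exact add_mem hS hT
    · rwa [Finset.sum_insert hi, ← add_assoc]
    · rw [← h p q g f hpq]
      have e1 : (X + (μ i : ℂ) • (annihilate (e i) * X * create (e i))) * createProd f * M *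
          (createProd g).adjoint = X * createProd f * M * (createProd g).adjoint + (μ i : ℂ) •
          (annihilate (e i) * X * create (e i) * createProd f * M * (createProd g).adjoint) := by
        simp only [add_mul, smul_mul_assoc]
      have e2 : X * createProd f * (M + (μ i : ℂ) • (create (e i) * M * annihilate (e i))) *
          (createProd g).adjoint = X * createProd f * M * (createProd g).adjoint + (μ i : ℂ) •
          (X * createProd f * (create (e i) * M * annihilate (e i)) * (createProd g).adjoint) := by
        simp only [mul_add, add_mul, smul_mul_assoc, mul_smul_comm]
      have f1 : HasFiniteRank (X * createProd f * M * (createProd g).adjoint) := by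
        simpa only [mul_assoc] using hfin.mul_right _
      have f2 : HasFiniteRank
          (annihilate (e i) * X * create (e i) * createProd f * M * (createProd g).adjoint) := by
        simpa only [mul_assoc] using (hfin.mul_right _).mul_left _
      have f3 : HasFiniteRank (X * createProd f * (create (e i) * M * annihilate (e i)) *
          (createProd g).adjoint) := by
        simpa only [mul_assoc] using hfin.mul_right _
      rw [e1, e2, trace_add f1 (f2.smul _), trace_add f1 (f3.smul _), trace_smul f2, trace_smul f3,
        trace_conj_annihilate hfin M _ hpq]

end Pieces

/-! ### Existence and uniqueness of localizations -/

section Localization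

variable {H : Type u} [NormedAddCommGroup H] [InnerProductSpace ℂ H]
  {N r k : ℕ} {E : Submodule ℂ H}

/-- A positive operator compressed to a finite-dimensional subspace, diagonalised. -/
theorem exists_compression_eq_sum {T : H →L[ℂ] H} (hT : T.IsPositive) (E : Submodule ℂ H)
    [FiniteDimensional ℂ E] :
    ∃ (n : ℕ) (e : Fin n → H) (μ : Fin n → ℝ), Orthonormal ℂ e ∧ (∀ i, e i ∈ E) ∧ (∀ i, 0 ≤ μ i) ∧
      E.starProjection * T * E.starProjection = ∑ i, (μ i : ℂ) • rankOne ℂ (e i) (e i) := by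
  have hK := hT.orthogonalProjectionOnto_comp E
  set K := E.orthogonalProjectionOnto ∘L T ∘L E.subtypeL with hKdef
  have hs := hK.isSymmetric
  let b := hs.eigenvectorBasis rfl
  refine ⟨_, fun i => (b i : H), hs.eigenvalues rfl,
    b.orthonormal.comp_linearIsometry E.subtypeₗᵢ, fun i => (b i).2, fun i => ?_, ?_⟩
  · exact hK.toLinearMap.nonneg_eigenvalues rfl i
  · ext x
    have h1 : (E.starProjection * T * E.starProjection) x =
        ((K (E.orthogonalProjectionOnto x) : E) : H) := rfl
    have h2 := congrArg K (b.sum_repr' (E.orthogonalProjectionOnto x))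
    have h3 : ∀ i, K (b i) = (hs.eigenvalues rfl i : ℂ) • b i := fun i =>
      hs.apply_eigenvectorBasis rfl i
    rw [h1, ← h2, map_sum, Submodule.coe_sum, sum_apply]
    refine Finset.sum_congr rfl fun i _ => ?_
    rw [map_smul, h3, smul_apply, rankOne_apply, smul_comm,
      E.inner_orthogonalProjectionOnto_eq_of_mem_left]
    rfl

variable [CompleteSpace H]

theorem isPositive_one_sub_adjoint_comp_self {B : H →L[ℂ] H} (hB : ∀ x, ‖B x‖ ≤ ‖x‖) :
    (1 - B.adjoint ∘L B).IsPositive := by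
  refine (ContinuousLinearMap.isPositive_def').2 ⟨?_, fun x => ?_⟩
  · exact (IsSelfAdjoint.one _).sub (ContinuousLinearMap.isPositive_adjoint_comp_self B).isSelfAdjoint
  · rw [ContinuousLinearMap.reApplyInnerSelf_apply, sub_apply, inner_sub_left, map_sub,
      ContinuousLinearMap.comp_apply, ContinuousLinearMap.adjoint_inner_left, one_apply_eq_self,
      inner_self_eq_norm_sq, inner_self_eq_norm_sq]
    have := pow_le_pow_left₀ (norm_nonneg _) (hB x) 2
    linarith

theorem norm_apply_le_of_comp_adjoint_le_one {B : H →L[ℂ] H} (hB : B ∘L B.adjoint ≤ 1) (x : H) :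
    ‖B x‖ ≤ ‖x‖ := by
  have h1 : ∀ x, ‖B.adjoint x‖ ≤ ‖x‖ := fun x => by
    have h := ((ContinuousLinearMap.le_def _ _).1 hB).re_inner_nonneg_right x
    rw [sub_apply, inner_sub_right, map_sub, one_apply_eq_self, ContinuousLinearMap.comp_apply,
      ← ContinuousLinearMap.adjoint_inner_left B, inner_self_eq_norm_sq,
      inner_self_eq_norm_sq] at h
    exact le_of_sq_le_sq (by linarith) (norm_nonneg x)
  have h2 : ‖B‖ ≤ 1 := by
    rw [← LinearIsometryEquiv.norm_map ContinuousLinearMap.adjoint B]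
    exact ContinuousLinearMap.opNorm_le_bound _ zero_le_one fun x => by simpa using h1 x
  simpa using B.le_of_opNorm_le h2 x

/-- Existence of the `B`-localization of a state living in a finite-dimensional one-body space,
as a finite sum of unnormalised states. -/
theorem IsPiece.exists_localization {Γ : Fock H →L[ℂ] Fock H} (hΓ : IsPiece N r N E Γ)
    {B : H →L[ℂ] H} (hB : B ∘L B.adjoint ≤ 1) :
    ∃ ΓB ∈ pieceSums N r (∅ : Set H), IsLocalization B Γ ΓB := by
  have := hΓ.finiteDimensional
  have hP : E.starProjection.adjoint = E.starProjection := isSelfAdjoint_starProjection E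
  have hPP := E.isIdempotentElem_starProjection.eq
  have hΓa := hΓ.isPositive.isSelfAdjoint.adjoint_eq
  obtain ⟨n, e, μ, he, heE, hμ, hsum⟩ :=
    exists_compression_eq_sum (isPositive_one_sub_adjoint_comp_self (norm_apply_le_of_comp_adjoint_le_one hB)) E
  obtain ⟨W, hW, -⟩ := exists_isSecondQuantization_starProjection E
  -- the localization only involves `B` on `E`, and `B P` has a bounded second quantization
  obtain ⟨V, hV, -⟩ : ∃ V, IsSecondQuantization (B * E.starProjection) V ∧ HasFiniteRank V := by
    refine HasFiniteRank.exists_isSecondQuantization (HasFiniteRank.mul_left ?_ B)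
    rw [(stdOrthonormalBasis ℂ E).starProjection_eq_sum_rankOne]
    exact ⟨_, _, _, rfl⟩
  have hBPa : (B * E.starProjection).adjoint = E.starProjection * B.adjoint := by
    rw [ContinuousLinearMap.mul_def, ContinuousLinearMap.adjoint_comp, hP]; rfl
  obtain ⟨X, hX, M', hM', htr⟩ := hΓ.exists_attenuation he heE hμ Finset.univ (hV.adjoint.mul hV)
  have hM'W : M' = W := by
    refine hM'.unique (?_ : IsSecondQuantization _ W)
    have : (B * E.starProjection).adjoint * (B * E.starProjection) +
        ∑ i, (μ i : ℂ) • rankOne ℂ (e i) (e i) = E.starProjection := by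
      rw [← hsum, hBPa, mul_sub, mul_one, sub_mul, hPP, add_sub_assoc']
      have : E.starProjection * (B.adjoint ∘L B) * E.starProjection =
        E.starProjection * B.adjoint * (B * E.starProjection) := rfl
      rw [this, add_sub_cancel_left]
    rwa [this]
  have hmem : V * X * V.adjoint ∈ pieceSums N r (∅ : Set H) := by
    refine pieceSums_induction (p := fun X => V * X * V.adjoint ∈ pieceSums N r (∅ : Set H))
      (fun k E T hT _ => ?_) ?_ ?_ hX
    · exact (hT.conj_secondQuantization hV).mem_pieceSums (Set.empty_subset _)
    · simp
    · intro S T hS hT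
      rw [mul_add, add_mul]
      exact add_mem hS hT
  refine ⟨V * X * V.adjoint, hmem, fun p q g f => ?_⟩
  by_cases hpq : Even (p + q)
  · have hfin := hasFiniteRank_of_mem_pieceSums hX
    have e1 := hV.adjoint.mul_createProd f
    have e2 := hV.adjoint_createProd_mul g
    rw [hBPa] at e1 e2
    rw [densityMatrix_eq, densityMatrix_eq_projection hΓ.supportedIn hΓa hW]
    calc _ = trace (V * (X * V.adjoint * createProd f * (createProd g).adjoint)) := by
          simp only [mul_assoc]
      _ = trace (X * (V.adjoint * createProd f) * ((createProd g).adjoint * V)) := by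
          rw [← trace_mul_comm (by simpa only [mul_assoc] using hfin.mul_right _)]
          simp only [mul_assoc]
      _ = trace (X * (createProd fun i => E.starProjection (B.adjoint (f i))) * (V.adjoint * V) *
            (createProd fun i => E.starProjection (B.adjoint (g i))).adjoint) := by
          rw [e1, e2]
          simp only [mul_assoc]
          rfl
      _ = _ := by
          rw [htr p q _ _ hpq, hM'W]
  · rw [hΓ.densityMatrix_eq_zero hpq]
    refine pieceSums_induction
      (p := fun T => HasFiniteRank T ∧ densityMatrix T g f = 0) ?_ ?_ ?_ hmem |>.2
    · exact fun k E T hT _ => ⟨hT.hasFiniteRank, hT.densityMatrix_eq_zero hpq g f⟩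
    · refine ⟨HasFiniteRank.zero, ?_⟩
      rw [densityMatrix_eq, zero_mul, zero_mul, HasTrace.zero.trace_eq]
    · rintro S T ⟨hS, hS0⟩ ⟨hT, hT0⟩
      refine ⟨hS.add hT, ?_⟩
      rw [densityMatrix_eq] at hS0 hT0 ⊢
      rw [add_mul, add_mul, trace_add (by simpa only [mul_assoc] using hS.mul_right _)
        (by simpa only [mul_assoc] using hT.mul_right _), hS0, hT0, add_zero]

theorem IsLocalization.trace_eq {B : H →L[ℂ] H} {Γ Γ' : Fock H →L[ℂ] Fock H}
    (h : IsLocalization B Γ Γ') : trace Γ' = trace Γ := by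
  rw [trace_eq_densityMatrix, h, trace_eq_densityMatrix]
  congr 1 <;> exact Subsingleton.elim _ _

/-- A state which is the `B`-localization of a state with particles in `E` has its particles in
`B E`. -/
theorem IsLocalization.supportedIn {B : H →L[ℂ] H} {Γ Γ' : Fock H →L[ℂ] Fock H}
    (h : IsLocalization B Γ Γ') (hΓ : IsPiece N r k E Γ) (hΓ' : IsState Γ') :
    SupportedIn (E.map (B : H →ₗ[ℂ] H)) Γ' := by
  have := hΓ.finiteDimensional
  obtain ⟨W, hW, -⟩ := exists_isSecondQuantization_starProjection E
  refine hΓ'.supportedIn fun g hg => ?_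
  have h0 : E.starProjection (B.adjoint g) = 0 := by
    refine (Submodule.starProjection_apply_eq_zero_iff E).2 fun x hx => ?_
    rw [ContinuousLinearMap.adjoint_inner_right]
    exact hg _ (Submodule.mem_map_of_mem hx)
  rw [h, densityMatrix_eq_projection hΓ.supportedIn hΓ.isPositive.isSelfAdjoint.adjoint_eq hW,
    createProd_one, h0, create_zero, mul_zero, zero_mul, zero_mul, HasTrace.zero.trace_eq]

theorem IsLocalization.unique {B : H →L[ℂ] H} {Γ Γ₁ Γ₂ : Fock H →L[ℂ] Fock H}
    (hΓ : IsPiece N r k E Γ) (h₁ : IsLocalization B Γ Γ₁) (h₂ : IsLocalization B Γ Γ₂)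
    (hs₁ : IsState Γ₁) (hs₂ : IsState Γ₂) : Γ₁ = Γ₂ := by
  have := hΓ.finiteDimensional
  have hE₁ := h₁.supportedIn hΓ hs₁
  have hE₂ := h₂.supportedIn hΓ hs₂
  refine sub_eq_zero.1 (eq_zero_of_densityMatrix (E := E.map (B : H →ₗ[ℂ] H))
    (fun g hg => by rw [mul_sub, hE₁ g hg, hE₂ g hg, sub_zero]) ?_ fun p q g f => ?_)
  · rw [map_sub, hs₁.1.isSelfAdjoint.adjoint_eq, hs₂.1.isSelfAdjoint.adjoint_eq]
  · have e := (h₁ p q g f).trans (h₂ p q g f).symm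
    rw [densityMatrix_eq, densityMatrix_eq] at e
    rw [densityMatrix_eq, sub_mul, sub_mul,
      trace_sub (by simpa only [mul_assoc] using hE₁.hasFiniteRank.mul_right _)
        (by simpa only [mul_assoc] using hE₂.hasFiniteRank.mul_right _), e, sub_self]

end Localization

/-! ### Traces of positive operators -/

section PositiveTrace

variable {X : Type u} [NormedAddCommGroup X] [InnerProductSpace ℂ X]

/-- Stated for a general space: for operators on `sector H k` the search for the scalar action is
slow. -/
theorem smul_inv_smul_clm {c : ℂ} (hc : c ≠ 0) (T : X →L[ℂ] X) : c • c⁻¹ • T = T :=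
  smul_inv_smul₀ hc T

variable [CompleteSpace X]

theorem HasFiniteRank.hasTrace_compress {T : X →L[ℂ] X} (hT : HasFiniteRank T)
    {K : Submodule ℂ X} [CompleteSpace K] (hK : ∀ x, T x ∈ K) :
    HasTrace (K.orthogonalProjectionOnto ∘L T ∘L K.subtypeL) (trace T) := by
  obtain ⟨n, u, v, rfl⟩ := hT
  set T := ∑ j, rankOne ℂ (u j) (v j) with hTdef
  have h1 : T = ∑ j, rankOne ℂ (K.starProjection (u j)) (v j) := by
    have e : K.starProjection ∘L T = T := by
      ext x
      exact Submodule.starProjection_eq_self_iff.2 (hK x)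
    rw [← e, hTdef]
    ext x
    simp
  have h2 : K.orthogonalProjectionOnto ∘L T ∘L K.subtypeL =
      ∑ j, rankOne ℂ (K.orthogonalProjectionOnto (u j)) (K.orthogonalProjectionOnto (v j)) := by
    ext x
    simp [hTdef]
  have h3 := HasTrace.sum Finset.univ fun j _ =>
    hasTrace_rankOne (K.starProjection (u j)) (v j)
  have h4 := HasTrace.sum Finset.univ fun j _ =>
    hasTrace_rankOne (K.orthogonalProjectionOnto (u j)) (K.orthogonalProjectionOnto (v j))
  rw [← h1] at h3
  rw [h2, h3.trace_eq]
  convert h4 using 3 with j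
  exact (K.inner_orthogonalProjectionOnto_eq_of_mem_right (K.orthogonalProjectionOnto (u j))
    (v j)).symm

/-- The trace of a positive operator is a nonnegative real number, and it is faithful. -/
theorem HasTrace.exists_real {T : X →L[ℂ] X} (hT : T.IsPositive) {z : ℂ} (h : HasTrace T z) :
    ∃ c : ℝ, 0 ≤ c ∧ z = c ∧ (c = 0 → T = 0) := by
  obtain ⟨S, hS, hST⟩ := hT.exists_sqrt
  obtain ⟨w, b, -⟩ := exists_hilbertBasis ℂ X
  have e : ∀ i, ⟪b i, T (b i)⟫_ℂ = ((‖S (b i)‖ ^ 2 : ℝ) : ℂ) := fun i => by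
    rw [← hST, ContinuousLinearMap.comp_apply, ← ContinuousLinearMap.adjoint_inner_left, hS,
      inner_self_eq_norm_sq_to_K]
    norm_cast
  have h1 := h w b
  simp only [e] at h1
  have hre := h1.mapL Complex.reCLM
  have him := h1.mapL Complex.imCLM
  simp only [Complex.reCLM_apply, Complex.imCLM_apply, Complex.ofReal_re, Complex.ofReal_im]
    at hre him
  have hz : z = (z.re : ℂ) := Complex.ext rfl (him.unique hasSum_zero)
  refine ⟨z.re, hre.nonneg fun i => sq_nonneg _, hz, fun h0 => ?_⟩
  rw [h0] at hre
  have h4 := (hasSum_zero_iff_of_nonneg fun i => sq_nonneg _).1 hre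
  have h5 : S = 0 := by
    refine ContinuousLinearMap.ext_on
      (Submodule.dense_iff_topologicalClosure_eq_top.2 b.dense_span) ?_
    rintro _ ⟨i, rfl⟩
    simpa using congrFun h4 i
  rw [← hST, h5, ContinuousLinearMap.comp_zero]

end PositiveTrace

/-! ### Blocks and rank combinations -/

section RankCombinations

variable {H : Type u} [NormedAddCommGroup H] [InnerProductSpace ℂ H]

theorem extendByZero_block_apply (k : ℕ) (T : Fock H →L[ℂ] Fock H) (ψ : Fock H) :
    extendByZero k (block k T) ψ =
      (sector H k).starProjection (T ((sector H k).starProjection ψ)) := rfl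

theorem extendByZero_block {k : ℕ} {T : Fock H →L[ℂ] Fock H} (hT : T.adjoint = T)
    (hk : ∀ ψ, T ψ ∈ sector H k) : extendByZero k (block k T) = T := by
  have h1 : (sector H k).starProjection ∘L T = T := by
    ext ψ : 1
    exact Submodule.starProjection_eq_self_iff.2 (hk ψ)
  have h2 : T ∘L (sector H k).starProjection = T := by
    have h := congrArg ContinuousLinearMap.adjoint h1
    rw [ContinuousLinearMap.adjoint_comp, hT] at h
    exact (congrArg (T ∘L ·) (isSelfAdjoint_starProjection (sector H k)).symm).trans h
  ext ψ : 1
  rw [extendByZero_block_apply]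
  exact (DFunLike.congr_fun h1 _).trans (DFunLike.congr_fun h2 ψ)

theorem block_eq_zero {j k : ℕ} (hjk : j ≠ k) {T : Fock H →L[ℂ] Fock H}
    (hj : ∀ ψ, T ψ ∈ sector H j) : block k T = 0 := by
  ext ψ : 1
  have h : T ψ ∈ (sector H k)ᗮ := fun φ hφ => inner_eq_zero_of_mem_sector hjk.symm hφ (hj _)
  exact (sector H k).orthogonalProjectionOnto_eq_zero_iff.2 h

theorem block_add (k : ℕ) (S T : Fock H →L[ℂ] Fock H) : block k (S + T) = block k S + block k T := by
  ext; simp [block]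

theorem extendByZero_add (k : ℕ) (S T : sector H k →L[ℂ] sector H k) :
    extendByZero k (S + T) = extendByZero k S + extendByZero k T := by
  ext; simp [extendByZero]

theorem extendByZero_smul (k : ℕ) (c : ℂ) (T : sector H k →L[ℂ] sector H k) :
    extendByZero k (c • T) = c • extendByZero k T := by
  ext; simp [extendByZero]

theorem extendByZero_zero (k : ℕ) : extendByZero k (0 : sector H k →L[ℂ] sector H k) = 0 := by
  ext; simp [extendByZero]

variable {N r k : ℕ} {E : Submodule ℂ H} {T : Fock H →L[ℂ] Fock H}

theorem eq_sum_block_of_mem_pieceSums {s : Set H} (hT : T ∈ pieceSums N r s) :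
    T = ∑ k ∈ Finset.range (N + 1), extendByZero k (block k T) := by
  refine pieceSums_induction
    (p := fun T => T = ∑ k ∈ Finset.range (N + 1), extendByZero k (block k T))
    (fun j E T h _ => ?_) ?_ (fun S T hS hT => ?_) hT
  · rw [Finset.sum_eq_single j, extendByZero_block h.isPositive.isSelfAdjoint.adjoint_eq h.mem_sector]
    · intro k _ hkj
      rw [block_eq_zero hkj.symm h.mem_sector, extendByZero_zero]
    · intro hj
      exact absurd (Finset.mem_range.2 (Nat.lt_succ_of_le h.le)) hj
  · refine (Finset.sum_eq_zero fun k _ => ?_).symm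
    ext ψ : 1
    simp [extendByZero_block_apply]
  · conv_lhs => rw [hS, hT]
    simp only [block_add, extendByZero_add, Finset.sum_add_distrib]

theorem mem_truncatedFock_of_mem_pieceSums {s : Set H} (hT : T ∈ pieceSums N r s) (ψ : Fock H) :
    T ψ ∈ truncatedFock H N := by
  refine pieceSums_induction (p := fun T => T ψ ∈ truncatedFock H N)
    (fun j E T h _ => ?_) ?_ (fun S T hS hT => ?_) hT
  · exact Submodule.mem_iSup_of_mem (⟨j, Nat.lt_succ_of_le h.le⟩ : Fin (N + 1)) (h.mem_sector ψ)
  · exact zero_mem _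
  · exact add_mem hS hT

variable [CompleteSpace H]

/-- The projection on `E` witnesses that the rank is at most the dimension of `E`. -/
theorem stateRank_le [FiniteDimensional ℂ E] (h : SupportedIn E T) (hT : T.adjoint = T) :
    stateRank T ≤ Module.finrank ℂ E := by
  refine (iInf₂_le E.starProjection
    ⟨isStarProjection_starProjection, isLocalization_starProjection h hT⟩).trans ?_
  rw [LinearMap.rank, E.range_starProjection, ← Module.finrank_eq_rank]
  simp

theorem isRankCombination_zero : IsRankCombination N r k (0 : sector H k →L[ℂ] sector H k) :=
  ⟨0, Fin.elim0, Fin.elim0, fun j => j.elim0, by simp [HasTrace.zero.trace_eq], fun j => j.elim0,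
    by simp⟩

theorem IsRankCombination.add {S T : sector H k →L[ℂ] sector H k}
    (hS : IsRankCombination N r k S) (hT : IsRankCombination N r k T) :
    IsRankCombination N r k (S + T) := by
  obtain ⟨m, α, A, hα, -, hA, rfl⟩ := hS
  obtain ⟨n, β, C, hβ, -, hC, rfl⟩ := hT
  have hst : ∀ j, IsState (Fin.append A C j) ∧
      stateRank (extendByZero k (Fin.append A C j)) + N ≤ r + k := fun j => by
    refine Fin.addCases (fun j => ?_) (fun j => ?_) j
    · simpa using hA j
    · simpa using hC j
  have hsum : ∑ j, (α j : ℂ) • A j + ∑ j, (β j : ℂ) • C j =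
      ∑ j, ((Fin.append α β j : ℝ) : ℂ) • Fin.append A C j := by
    simp [Fin.sum_univ_add]
  refine ⟨m + n, Fin.append α β, Fin.append A C, fun j => ?_, ?_, hst, hsum⟩
  · refine Fin.addCases (fun j => ?_) (fun j => ?_) j
    · simpa using hα j
    · simpa using hβ j
  · have := HasTrace.sum Finset.univ fun j _ => HasTrace.smul ((Fin.append α β j : ℝ) : ℂ) (hst j).1.2
    rw [hsum, this.trace_eq]
    simp

theorem IsPiece.isRankCombination_block (h : IsPiece N r k E T) :
    IsRankCombination N r k (block k T) := by
  have := h.finiteDimensional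
  have hTa := h.isPositive.isSelfAdjoint.adjoint_eq
  have htr := h.hasFiniteRank.hasTrace_compress (K := sector H k) h.mem_sector
  obtain ⟨c, hc, htc, h0⟩ := h.hasFiniteRank.hasTrace.exists_real h.isPositive
  rw [htc] at htr
  rcases hc.eq_or_lt with hc0 | hcpos
  -- a piece of trace zero vanishes, the others are multiples of a state
  · have : block k T = 0 := by
      rw [h0 hc0.symm]
      ext; simp [block]
    rw [this]
    exact isRankCombination_zero
  · have hc' : (c : ℂ) ≠ 0 := by exact_mod_cast hcpos.ne'
    refine ⟨1, fun _ => c, fun _ => (c : ℂ)⁻¹ • block k T, fun _ => hc, ?_, fun _ => ⟨⟨?_, ?_⟩, ?_⟩, ?_⟩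
    · rw [block, htr.trace_eq]
      simp
    · refine (h.isPositive.orthogonalProjectionOnto_comp _).smul_of_nonneg ?_
      rw [← Complex.ofReal_inv]
      exact_mod_cast inv_nonneg.2 hc
    · have := htr.smul (c : ℂ)⁻¹
      rwa [inv_mul_cancel₀ hc'] at this
    · rw [extendByZero_smul, extendByZero_block hTa h.mem_sector]
      have h1 : stateRank ((c : ℂ)⁻¹ • T) ≤ Module.finrank ℂ E := by
        refine stateRank_le (fun g hg => ?_) ?_
        · rw [mul_smul_comm, h.supportedIn g hg, smul_zero]
        · rw [map_smulₛₗ, hTa, map_inv₀, Complex.conj_ofReal]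
      calc _ ≤ (Module.finrank ℂ E : ℕ∞) + N := by gcongr
        _ ≤ _ := by exact_mod_cast h.finrank_add_le
    · rw [Fin.sum_univ_one]
      exact (smul_inv_smul_clm hc' _).symm

theorem isRankCombination_block_of_mem_pieceSums {s : Set H} (hT : T ∈ pieceSums N r s) (k : ℕ) :
    IsRankCombination N r k (block k T) := by
  refine pieceSums_induction (p := fun T => IsRankCombination N r k (block k T))
    (fun j E T h _ => ?_) ?_ (fun S T hS hT => ?_) hT
  · by_cases hjk : j = k
    · subst hjk
      exact h.isRankCombination_block
    · rw [block_eq_zero hjk h.mem_sector]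
      exact isRankCombination_zero
  · have : block k (0 : Fock H →L[ℂ] Fock H) = 0 := by ext; simp [block]
    rw [this]
    exact isRankCombination_zero
  · rw [block_add]
    exact hS.add hT

/-- Localization of a state of `N` particles in a finite-dimensional one-body space. -/
theorem IsPiece.exists_localization_isRankCombination {Γ : Fock H →L[ℂ] Fock H}
    (hΓ : IsPiece N r N E Γ) (hs : IsState Γ) {B : H →L[ℂ] H} (hB : B ∘L B.adjoint ≤ 1) :
    ∃ ΓB : Fock H →L[ℂ] Fock H,
      (IsTruncatedState N ΓB ∧ IsLocalization B Γ ΓB) ∧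
      (∀ Γ' : Fock H →L[ℂ] Fock H, IsTruncatedState N Γ' → IsLocalization B Γ Γ' → Γ' = ΓB) ∧
      ΓB = ∑ k ∈ Finset.range (N + 1), extendByZero k (block k ΓB) ∧
      ∀ k ≤ N, IsRankCombination N r k (block k ΓB) := by
  obtain ⟨ΓB, hmem, hloc⟩ := hΓ.exists_localization hB
  have hsB : IsState ΓB := by
    refine ⟨isPositive_of_mem_pieceSums hmem, ?_⟩
    have h := (hasFiniteRank_of_mem_pieceSums hmem).hasTrace
    rwa [hloc.trace_eq, HasTrace.trace_eq hs.2] at h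
  exact ⟨ΓB, ⟨⟨hsB, mem_truncatedFock_of_mem_pieceSums hmem⟩, hloc⟩,
    fun Γ' h' hl' => hl'.unique hΓ hloc h'.1 hsB, eq_sum_block_of_mem_pieceSums hmem,
    fun k _ => isRankCombination_block_of_mem_pieceSums hmem k⟩

theorem exists_of_stateRank_le {T : Fock H →L[ℂ] Fock H} (h : stateRank T ≤ r) :
    ∃ P : H →L[ℂ] H, IsLocalization P T T ∧ FiniteDimensional ℂ P.range ∧
      Module.finrank ℂ P.range ≤ r := by
  by_contra! hcon
  have : ((r + 1 : ℕ) : ℕ∞) ≤ stateRank T := le_iInf₂ fun P hP => by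
    by_contra! hlt
    have h1 : Cardinal.toENat (LinearMap.rank (P : H →ₗ[ℂ] H)) ≤ (r : ℕ∞) := by
      have := ENat.add_one_le_iff (m := Cardinal.toENat (LinearMap.rank (P : H →ₗ[ℂ] H)))
        (n := ((r + 1 : ℕ) : ℕ∞)) hlt.ne_top
      have h2 := this.2 hlt
      push_cast at h2
      exact (ENat.add_le_add_iff_right ENat.one_ne_top).1 h2
    rw [Cardinal.toENat_le_natCast, LinearMap.rank] at h1
    have hfd : FiniteDimensional ℂ P.range :=
      Module.rank_lt_aleph0_iff.1 (h1.trans_lt (Cardinal.natCast_lt_aleph0))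
    exact absurd (Module.finrank_le_of_rank_le h1) (hcon P hP.2 hfd).not_ge
  have := this.trans h
  norm_cast at this
  omega

/-- A state of `N` particles of rank at most `r` lives in a one-body space of dimension at most
`r`. -/
theorem exists_isPiece_of_stateRank_le {G : sector H N →L[ℂ] sector H N} (hG : IsState G)
    (h : stateRank (extendByZero N G) ≤ r) :
    ∃ E : Submodule ℂ H, IsPiece N r N E (extendByZero N G) := by
  obtain ⟨P, hP, hfd, hr⟩ := exists_of_stateRank_le h
  have hs : IsState (extendByZero N G) := hG.conj_subtype
  refine ⟨P.range, hs.1, fun ψ => Submodule.coe_mem _, hs.supportedIn fun g hg => ?_, hfd,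
    by omega, le_rfl⟩
  have h0 : P.adjoint g = 0 := ext_inner_left ℂ fun x => by
    rw [ContinuousLinearMap.adjoint_inner_right, inner_zero_right]
    exact hg _ ⟨x, rfl⟩
  rw [hP, densityMatrix_eq, createProd_one, h0, create_zero, mul_zero, zero_mul,
    HasTrace.zero.trace_eq]

end RankCombinations

/-! ### Geometric limits -/

section Limits

/-- Pointwise limits along an ultrafilter of contractions with values in a fixed finite-dimensional
space. -/
theorem exists_ultrafilter_limit {X : Type u} [NormedAddCommGroup X] [InnerProductSpace ℂ X]
    (𝒰 : Ultrafilter ℕ) (T : ℕ → X →L[ℂ] X) (L : Submodule ℂ X) [FiniteDimensional ℂ L]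
    (hL : ∀ n x, T n x ∈ L) (hT : ∀ n x, ‖T n x‖ ≤ ‖x‖) :
    ∃ S : X →L[ℂ] X, (∀ x, S x ∈ L) ∧ (∀ x, ‖S x‖ ≤ ‖x‖) ∧
      ∀ x, Tendsto (fun n => T n x) 𝒰 (𝓝 (S x)) := by
  have := FiniteDimensional.proper ℂ L
  have key : ∀ x, ∃ y ∈ L, ‖y‖ ≤ ‖x‖ ∧ Tendsto (fun n => T n x) 𝒰 (𝓝 y) := by
    intro x
    have hc : IsCompact ((↑) '' Metric.closedBall (0 : L) ‖x‖ : Set X) :=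
      (isCompact_closedBall (0 : L) ‖x‖).image continuous_subtype_val
    obtain ⟨_, ⟨y, hy, rfl⟩, hlim⟩ := hc.ultrafilter_le_nhds (𝒰.map fun n => T n x)
      (le_principal_iff.2 <| Filter.mem_map.2 <| Filter.univ_mem' fun n =>
        ⟨⟨T n x, hL n x⟩, by simpa using hT n x, rfl⟩)
    exact ⟨y, y.2, by simpa using hy, hlim⟩
  choose S hSL hSn hlim using key
  let S' : X →ₗ[ℂ] X :=
    { toFun := S
      map_add' := fun x y => tendsto_nhds_unique (hlim (x + y)) <| by
        simpa only [map_add] using (hlim x).add (hlim y)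
      map_smul' := fun c x => tendsto_nhds_unique (hlim (c • x)) <| by
        simpa only [map_smul, RingHom.id_apply] using (hlim x).const_smul c }
  exact ⟨S'.mkContinuous 1 fun x => (hSn x).trans_eq (one_mul _).symm, hSL, hSn, hlim⟩

variable {H : Type u} [NormedAddCommGroup H] [InnerProductSpace ℂ H] [CompleteSpace H]
  {N r k : ℕ} {E F : Submodule ℂ H}

/-- A partial isometry `C` with initial space `E` and final space inside `F`. -/
theorem exists_partial_isometry (E F : Submodule ℂ H) [FiniteDimensional ℂ E]
    [FiniteDimensional ℂ F] (h : Module.finrank ℂ E ≤ Module.finrank ℂ F) :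
    ∃ C : H →L[ℂ] H, (∀ x, C x ∈ F) ∧ (∀ x, ‖C x‖ ≤ ‖x‖) ∧ C.adjoint * C = E.starProjection ∧
      HasFiniteRank C := by
  set e := stdOrthonormalBasis ℂ E
  set f := stdOrthonormalBasis ℂ F
  have hf : Orthonormal ℂ fun i => (f (Fin.castLE h i) : H) :=
    (f.orthonormal.comp _ (Fin.castLE_injective h)).comp_linearIsometry F.subtypeₗᵢ
  let C : H →L[ℂ] H := ∑ i, rankOne ℂ (f (Fin.castLE h i) : H) (e i : H)
  have hC : C.adjoint * C = E.starProjection := by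
    rw [e.starProjection_eq_sum_rankOne]
    simp only [C, map_sum, Finset.sum_mul, Finset.mul_sum, adjoint_rankOne,
      ContinuousLinearMap.mul_def, rankOne_comp_rankOne]
    refine Finset.sum_congr rfl fun i _ => ?_
    rw [Finset.sum_eq_single i]
    · rw [inner_self_eq_one_of_norm_eq_one (hf.1 i), one_smul]
    · intro j _ hji
      rw [hf.2 hji, zero_smul]
    · simp
  refine ⟨C, fun x => ?_, fun x => ?_, hC, ⟨_, _, _, rfl⟩⟩
  · simp only [C, sum_apply, rankOne_apply]
    exact F.sum_mem fun i _ => F.smul_mem _ (Subtype.prop _)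
  · refine le_of_sq_le_sq ?_ (norm_nonneg x)
    have h1 : ⟪x, E.starProjection x⟫_ℂ = ⟪C x, C x⟫_ℂ := by
      rw [← hC, ContinuousLinearMap.mul_def, ContinuousLinearMap.comp_apply,
        ContinuousLinearMap.adjoint_inner_right]
    have h2 : ‖C x‖ ^ 2 = RCLike.re ⟪x, E.starProjection x⟫_ℂ := by
      rw [h1, inner_self_eq_norm_sq]
    rw [h2, sq]
    refine (re_inner_le_norm _ _).trans ?_
    gcongr
    exact E.norm_starProjection_apply_le x

/-- A state living in `E` is unitarily equivalent to a state living in a space `F` of at least the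
same dimension. -/
theorem IsPiece.exists_transfer {Γ : Fock H →L[ℂ] Fock H} (hΓ : IsPiece N r N E Γ)
    (hs : IsState Γ) [FiniteDimensional ℂ F]
    (hdim : Module.finrank ℂ E ≤ Module.finrank ℂ F) (hF : Module.finrank ℂ F ≤ r) :
    ∃ (C : H →L[ℂ] H) (Γ' : Fock H →L[ℂ] Fock H), (∀ x, C x ∈ F) ∧ (∀ x, ‖C x‖ ≤ ‖x‖) ∧
      IsPiece N r N F Γ' ∧ IsState Γ' ∧ ∀ (p q : ℕ) (g : Fin p → H) (f : Fin q → H),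
        densityMatrix Γ g f = densityMatrix Γ' (fun i => C (g i)) (fun i => C (f i)) := by
  have := hΓ.finiteDimensional
  obtain ⟨C, hCF, hCn, hCC, hCfin⟩ := exists_partial_isometry E F hdim
  obtain ⟨V, hV, -⟩ := hCfin.exists_isSecondQuantization
  have hVV : IsSecondQuantization E.starProjection (V.adjoint * V) := hCC ▸ hV.adjoint.mul hV
  have hfin := hΓ.hasFiniteRank
  have hdm : ∀ (p q : ℕ) (g : Fin p → H) (f : Fin q → H), densityMatrix Γ g f =
      densityMatrix (V * Γ * V.adjoint) (fun i => C (g i)) (fun i => C (f i)) := by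
    intro p q g f
    have e1 := hV.adjoint.mul_createProd fun i => C (f i)
    have e2 := hV.adjoint_createProd_mul fun i => C (g i)
    have e3 : ∀ x, C.adjoint (C x) = E.starProjection x := fun x => DFunLike.congr_fun hCC x
    simp only [e3] at e1 e2
    rw [densityMatrix_eq_projection hΓ.supportedIn hΓ.isPositive.isSelfAdjoint.adjoint_eq hVV,
      densityMatrix_eq]
    symm
    calc _ = trace (V * (Γ * V.adjoint * (createProd fun i => C (f i)) *
          (createProd fun i => C (g i)).adjoint)) := by simp only [mul_assoc]
      _ = trace (Γ * (V.adjoint * createProd fun i => C (f i)) *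
          ((createProd fun i => C (g i)).adjoint * V)) := by
          rw [← trace_mul_comm (by simpa only [mul_assoc] using hfin.mul_right _)]
          simp only [mul_assoc]
      _ = _ := by
          rw [e1, e2]
          simp only [mul_assoc]
  have hp := hΓ.conj_secondQuantization hV
  have htr : trace (V * Γ * V.adjoint) = trace Γ := by
    rw [trace_eq_densityMatrix, trace_eq_densityMatrix, hdm]
    congr 1 <;> exact Subsingleton.elim _ _
  refine ⟨C, V * Γ * V.adjoint, hCF, hCn, ⟨hp.isPositive, hp.mem_sector, hp.supportedIn.mono ?_,
    inferInstance, by omega, le_rfl⟩, ⟨hp.isPositive, ?_⟩, hdm⟩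
  · rintro _ ⟨x, -, rfl⟩
    exact hCF x
  · have h := hp.hasFiniteRank.hasTrace
    rwa [htr, HasTrace.trace_eq hs.2] at h

/-- The limit of a geometrically convergent sequence of states of `N` particles of rank at most `r`
is a localization of one such state: after transport to a fixed `r`-dimensional space the states
have a limit point in norm, and so does the transport itself, whose limit is a mere contraction. -/
theorem exists_isLocalization_of_geomTendsto {Γs : ℕ → Fock H →L[ℂ] Fock H}
    (hs : ∀ n, IsState (Γs n)) (hp : ∀ n, ∃ E, IsPiece N r N E (Γs n)) {Γ : Fock H →L[ℂ] Fock H}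
    (hlim : GeomTendsto Γs Γ) :
    ∃ (B : H →L[ℂ] H) (F : Submodule ℂ H) (Γ' : Fock H →L[ℂ] Fock H), B ∘L B.adjoint ≤ 1 ∧
      IsPiece N r N F Γ' ∧ IsState Γ' ∧ IsLocalization B Γ' Γ := by
  choose E hE using hp
  -- a target space of maximal dimension
  obtain ⟨n₀, hn₀⟩ : ∃ n₀, ∀ n, Module.finrank ℂ (E n) ≤ Module.finrank ℂ (E n₀) := by
    have hb : BddAbove (Set.range fun n => Module.finrank ℂ (E n)) := by
      refine ⟨r, ?_⟩
      rintro _ ⟨n, rfl⟩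
      have := (hE n).finrank_add_le
      simp only
      omega
    obtain ⟨n₀, h₀⟩ := Nat.sSup_mem (Set.range_nonempty _) hb
    exact ⟨n₀, fun n => (le_csSup hb ⟨n, rfl⟩).trans_eq h₀.symm⟩
  have hFd := (hE n₀).finiteDimensional
  have hFr : Module.finrank ℂ (E n₀) ≤ r := by
    have := (hE n₀).finrank_add_le
    omega
  generalize E n₀ = F at hn₀ hFd hFr
  choose C T hCF hCn hTp hTs hdm using fun n => (hE n).exists_transfer (hs n) (hn₀ n) hFr
  obtain ⟨W, hW, hWfin⟩ := exists_isSecondQuantization_starProjection F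
  obtain ⟨L, hLfd, hWL⟩ := hWfin.exists_finiteDimensional
  have hTL : ∀ n ψ, T n ψ ∈ L := fun n ψ => by
    rw [← (hTp n).supportedIn.secondQuantization_mul hW]
    exact hWL _
  let 𝒰 : Ultrafilter ℕ := Filter.hyperfilter ℕ
  have h𝒰 : (𝒰 : Filter ℕ) ≤ atTop := Nat.hyperfilter_le_atTop
  obtain ⟨C', -, hC'n, hC'⟩ := exists_ultrafilter_limit 𝒰 C F hCF hCn
  obtain ⟨T', hT'L, -, hT'⟩ :=
    exists_ultrafilter_limit 𝒰 T L hTL fun n => (hTs n).norm_apply_le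
  have hpos : T'.IsPositive := by
    refine (ContinuousLinearMap.isPositive_iff_complex T').2 fun x => ?_
    have h1 : Tendsto (fun n => ⟪T n x, x⟫_ℂ) 𝒰 (𝓝 ⟪T' x, x⟫_ℂ) := (hT' x).inner tendsto_const_nhds
    have h2 : Tendsto (fun n => (⟪T n x, x⟫_ℂ).re) 𝒰 (𝓝 (⟪T' x, x⟫_ℂ).re) :=
      (Complex.continuous_re.tendsto _).comp h1
    have h3 := fun n => (ContinuousLinearMap.isPositive_iff_complex (T n)).1 (hTp n).isPositive x
    refine ⟨tendsto_nhds_unique ((Complex.continuous_ofReal.tendsto _).comp h2) ?_,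
      ge_of_tendsto' h2 fun n => (h3 n).2⟩
    exact h1.congr fun n => (h3 n).1.symm
  have hpiece : IsPiece N r N F T' :=
    { isPositive := hpos
      mem_sector := fun ψ => (isClosed_sector N).mem_of_tendsto (hT' ψ)
        (Eventually.of_forall fun n => (hTp n).mem_sector ψ)
      supportedIn := fun g hg => by
        ext ψ : 1
        refine tendsto_nhds_unique (((annihilate g).continuous.tendsto _).comp (hT' ψ)) ?_
        refine tendsto_const_nhds.congr fun n => ?_
        exact (DFunLike.congr_fun ((hTp n).supportedIn g hg) ψ).symm
      finiteDimensional := hFd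
      finrank_add_le := by omega
      le := le_rfl }
  -- expectations in the states `T n` are finite sums over a basis of `L`
  have htr : ∀ (A : ℕ → Fock H →L[ℂ] Fock H) (A' : Fock H →L[ℂ] Fock H),
      Tendsto A 𝒰 (𝓝 A') → Tendsto (fun n => trace (T n * A n)) 𝒰 (𝓝 (trace (T' * A'))) := by
    intro A A' hA
    let w := stdOrthonormalBasis ℂ L
    have h1 : ∀ S D : Fock H →L[ℂ] Fock H, S.IsPositive → (∀ ψ, S ψ ∈ L) →
        trace (S * D) = ∑ j, ⟪S (w j), D (w j)⟫_ℂ := fun S D hS hSL => by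
      rw [trace_eq_sum_of_mem w (T := S * D) fun ψ => hSL _]
      exact Finset.sum_congr rfl fun j _ => (hS.isSymmetric _ _).symm
    rw [h1 T' A' hpos hT'L]
    simp only [fun n => h1 (T n) (A n) (hTp n).isPositive (hTL n)]
    refine tendsto_finsetSum _ fun j _ => (hT' _).inner ?_
    exact ((ContinuousLinearMap.apply ℂ (Fock H) (w j : Fock H)).continuous.tendsto _).comp hA
  have hstate : IsState T' := by
    refine ⟨hpos, ?_⟩
    have h := hpiece.hasFiniteRank.hasTrace
    have h1 := htr (fun _ => 1) 1 tendsto_const_nhds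
    simp only [mul_one, fun n => HasTrace.trace_eq (hTs n).2] at h1
    rwa [tendsto_nhds_unique h1 tendsto_const_nhds] at h
  refine ⟨C'.adjoint, F, T', ?_, hpiece, hstate, fun p q g f => ?_⟩
  · rw [ContinuousLinearMap.adjoint_adjoint, ContinuousLinearMap.le_def]
    exact isPositive_one_sub_adjoint_comp_self hC'n
  · rw [ContinuousLinearMap.adjoint_adjoint]
    refine tendsto_nhds_unique ((hlim p q g f).mono_left h𝒰) ?_
    simp only [hdm, densityMatrix_eq, mul_assoc]
    have hcr : ∀ (m : ℕ) (v : Fin m → H), Tendsto (fun n => createProd fun i => C n (v i)) 𝒰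
        (𝓝 (createProd fun i => C' (v i))) := fun m v =>
      (continuous_createProd.tendsto _).comp (tendsto_pi_nhds.2 fun i => hC' (v i))
    exact htr _ _ ((hcr q f).mul ((ContinuousLinearMap.adjoint.continuous.tendsto _).comp (hcr p g)))

end Limits

end Fermi

theorem mainTheorem10 {H : Type*} [NormedAddCommGroup H] [InnerProductSpace ℂ H] [CompleteSpace H]
    (N r : ℕ) :
    (∀ G : Fermi.sector H N →L[ℂ] Fermi.sector H N, Fermi.IsState G →
      Fermi.stateRank (Fermi.extendByZero N G) ≤ r →
      ∀ B : H →L[ℂ] H, B ∘L B.adjoint ≤ 1 →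
        ∃ ΓB : Fermi.Fock H →L[ℂ] Fermi.Fock H,
          (Fermi.IsTruncatedState N ΓB ∧
            Fermi.IsLocalization B (Fermi.extendByZero N G) ΓB) ∧
          (∀ Γ' : Fermi.Fock H →L[ℂ] Fermi.Fock H, Fermi.IsTruncatedState N Γ' →
            Fermi.IsLocalization B (Fermi.extendByZero N G) Γ' → Γ' = ΓB) ∧
          ΓB = ∑ k ∈ Finset.range (N + 1), Fermi.extendByZero k (Fermi.block k ΓB) ∧
          ∀ k ≤ N, Fermi.IsRankCombination N r k (Fermi.block k ΓB)) ∧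
    (∀ G : ℕ → (Fermi.sector H N →L[ℂ] Fermi.sector H N), (∀ n, Fermi.IsState (G n)) →
      (∀ n, Fermi.stateRank (Fermi.extendByZero N (G n)) ≤ r) →
      ∀ Γ : Fermi.Fock H →L[ℂ] Fermi.Fock H, Fermi.IsTruncatedState N Γ →
        Fermi.GeomTendsto (fun n => Fermi.extendByZero N (G n)) Γ →
        Γ = ∑ k ∈ Finset.range (N + 1), Fermi.extendByZero k (Fermi.block k Γ) ∧
        ∀ k ≤ N, Fermi.IsRankCombination N r k (Fermi.block k Γ)) := by
  refine ⟨fun G hG hr B hB => ?_, fun G hG hr Γ hΓ hlim => ?_⟩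
  · obtain ⟨E, hE⟩ := Fermi.exists_isPiece_of_stateRank_le hG hr
    exact hE.exists_localization_isRankCombination hG.conj_subtype hB
  · obtain ⟨B, F, Γ', hB, hF, hs, hloc⟩ := Fermi.exists_isLocalization_of_geomTendsto
      (fun n => (hG n).conj_subtype)
      (fun n => Fermi.exists_isPiece_of_stateRank_le (hG n) (hr n)) hlim
    obtain ⟨ΓB, -, huniq, hblock, hrank⟩ := hF.exists_localization_isRankCombination hs hB
    rw [huniq Γ hΓ hloc]
    exact ⟨hblock, hrank⟩
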